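/- Lemma 4.3 (lem:krUMrelation). Let $a,b\ge 1$ be integers, let $F=k_v$ be the completion of a number field $k$ at an arbitrary place $v$, with normalized absolute value $|\cdot|$, and fix a Haar measure on $F$. Let $j_n$ be the $n\times n$ matrix with ones on the second diagonal and zeros elsewhere, $J_{2n}=\begin{pmatrix}0&j_n\\-j_n&0\end{pmatrix}$, and $G_n=\mathrm{Sp}_{2n}(F)=\{g\in \mathrm{GL}_{2n}(F): {}^tgJ_{2n}g=J_{2n}\}$. For $h\in\mathrm{GL}_n(F)$ put $\tilde h=j_n\,{}^th^{-1}j_n$ and $m(h)=\mathrm{diag}(h,\tilde h)\in G_n$. Let $i:G_{a(b-1)}\to G_{ab}$, $i(g')=\mathrm{diag}(1_a,g',1_a)$, and $(i^*\Phi)(g')=\Phi(i(g'))$ for functions $\Phi$ on $G_{ab}$. Let $\Lambda_b=\left(\frac{b-1}2,\frac{b-3}2,\dots,\frac{1-b}2\right)$. Let $P_{a^b}$ denote the standard (block upper triangular) parabolic subgroup with Levi subgroup $\mathrm{GL}_a(F)^b$, embedded as $\mathrm{diag}(t_1,\dots,t_b)$ in $\mathrm{GL}_{ab}(F)$ and as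 $m(\mathrm{diag}(t_1,\dots,t_b))$ in $G_{ab}$; similarly for $P_{a^{b-1}}$ in $G_{a(b-1)}$. For a unitary representation $\pi$ of $\mathrm{GL}_a(F)^b$ on a Hilbert space $H$ and $\lambda\in\mathbb C^b$, let $\mathrm{Ind}_{P_{a^b}}(\pi,\lambda)$ (on $\mathrm{GL}_{ab}(F)$ or on $G_{ab}$) be the space of continuous $H$-valued functions $f$, left invariant under the unipotent radical of $P_{a^b}$, with $f(tg)=\prod_i|\det t_i|^{\lambda_i+\rho_i}\,\pi(t)f(g)$ for $t=(t_1,\dots,t_b)$ in the Levi subgroup. Here $\rho_i=a\frac{b+1-2i}{2}$ for $\mathrm{GL}_{ab}$ and $\rho_i=a\left(b-i+\frac12\right)+\frac12$ for $G_{ab}$ ($1\le i\le b$). Let $\Delta$ be any subspace of $\mathrm{Ind}_{P_{a^b}}^{\mathrm{GL}_{ab}}(\pi,-\Lambda_b)$ that is stable under right translation. (For example, $\pi=\tau_v^{\otimes b}$ and $\Delta$ a realization of the local component at $v$ of the Speh representation $\Delta(\tau,b)$, where $\tau$ is an irreducible unitary cuspidal automorphic representation of $\mathrm{GL}_a$.)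 For $s\in\mathbb C$ let $\mathrm{Ind}(\Delta,s)$ be the space of continuous $\Phi:G_{ab}\to H$ that are left invariant under the unipotent radical of the Siegel parabolic and such that, for every $g\in G_{ab}$, the function $r\mapsto|\det r|^{-s-\frac{ab+1}2}\,\Phi(m(r)g)$ on $\mathrm{GL}_{ab}(F)$ belongs to $\Delta$. For a positive multiple $n$ of $a$, or $n=0$, define $$\left(M_{n}^{n}\Phi\right)(g)=\int_{Y}\Phi\left(\begin{pmatrix}0&1_n\\-1_n&0\end{pmatrix}\begin{pmatrix}1_n&Y\\0&1_n\end{pmatrix}g\right)dY,\qquad g\in G_n,$$ where $Y$ ranges over the $n\times n$ matrices over $F$ that are symmetric around the second diagonal. In blocks of sizes $a,a(b-1),a(b-1),a$, put $$v''(X,Z)=\begin{pmatrix}1&X&0&Z\\0&1&0&0\\0&0&1&X'\\0&0&0&1\end{pmatrix},\qquad X'=-j_{a(b-1)}\,{}^tX\,j_a,$$ and let $\hat w$ be the matrix $$\hat w=\begin{pmatrix}0&1_{a(b-1)}&0&0\\0&0&0&1_a\\-1_a&0&0&0\\0&0&1_{a(b-1)}&0\end{pmatrix}$$ with columns in blocks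 of sizes $a,a(b-1),a(b-1),a$ and rows in blocks of sizes $a(b-1),a,a,a(b-1)$. Define $$(\mathscr U_{\hat w}\Phi)(g)=\int\!\!\int\Phi\left(\hat w\,v''(X,Z)\,g\right)dX\,dZ,\qquad g\in G_{ab},$$ where $X$ ranges over all $a\times a(b-1)$ matrices over $F$ and $Z$ over the $a\times a$ matrices over $F$ that are symmetric around the second diagonal. All measures are the products of the fixed Haar measure on $F$ over the independent matrix entries. Then there is a real number $\sigma_0$, depending only on $a$ and $b$, such that for all $s$ with $\mathrm{Re}\,s>\sigma_0$ and all $\Phi\in\mathrm{Ind}(\Delta,s)$: (1) the integrals defining $\mathscr U_{\hat w}\Phi$ and $M_{ab}^{ab}\Phi$ converge absolutely at every $g\in G_{ab}$; (2) $i^*\mathscr U_{\hat w}\Phi$ belongs to $\mathrm{Ind}_{P_{a^{b-1}}}^{G_{a(b-1)}}\left(\pi^{\flat},\left(s-\tfrac12,\dots,s-\tfrac12\right)-\Lambda_{b-1}\right)$, where $\pi^{\flat}$ is the restriction of $\pi$ to the first $b-1$ factors of $\mathrm{GL}_a(F)^b$, and the integral defining $M^{a(b-1)}_{a(b-1)}\left(i^*\mathscr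 U_{\hat w}\Phi\right)$ converges absolutely at every point of $G_{a(b-1)}$; (3) $M^{a(b-1)}_{a(b-1)}\left(i^*\,\mathscr U_{\hat w}\Phi\right)=i^*\left(M^{ab}_{ab}\Phi\right)$ as functions on $G_{a(b-1)}$. That is, $M_{a(b-1)}^{a(b-1)}\left(s-\tfrac12\right)\circ i^*\circ\mathscr U_{\hat w}(s)=i^*\circ M_{ab}^{ab}(s)$ on $\mathrm{Ind}(\Delta,s)$. -/

import Mathlib

open MeasureTheory Matrix

/-!
Conventions.  `F` is a local field of characteristic zero (a completion of a number field at any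
place, archimedean or not).  Matrices of size `a * b` are indexed by `Idx a b`, where `(p, i)` is
the `p`-th coordinate of the `i`-th block of size `a` (blocks are ordered by `i`, and the
coordinates inside a block by `p`).  Matrices of size `2 * a * b` are indexed by
`Idx a b ⊕ Idx a b`: first half of the coordinates, then second half.
-/

/-- Indices `1, …, ab`, grouped in `b` consecutive blocks of length `a`. -/
abbrev Idx (a b : ℕ) : Type := Fin a × Fin b

/-- The order reversal `x ↦ ab + 1 - x`. -/
def idxRev {a b : ℕ} (x : Idx a b) : Idx a b := (x.1.rev, x.2.rev)

theorem idxRev_idxRev {a b : ℕ} (x : Idx a b) : idxRev (idxRev x) = x := by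
  simp [idxRev]

/-- The matrix `j` with ones on the second diagonal. -/
def jMat (R : Type*) [Zero R] [One R] (a b : ℕ) : Matrix (Idx a b) (Idx a b) R :=
  Matrix.of fun x y => if y = idxRev x then 1 else 0

/-- `J = (0, j; -j, 0)`. -/
def JMat (R : Type*) [CommRing R] (a b : ℕ) : Matrix (Idx a b ⊕ Idx a b) (Idx a b ⊕ Idx a b) R :=
  fromBlocks 0 (jMat R a b) (-jMat R a b) 0

section Algebra

variable {R : Type*} [CommRing R]

theorem jMat_mul_apply {ι : Type*} {a b : ℕ} (A : Matrix (Idx a b) ι R) (x : Idx a b) (y : ι) :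
    (jMat R a b * A) x y = A (idxRev x) y := by
  simp [jMat, Matrix.mul_apply]

theorem mul_jMat_apply {ι : Type*} {a b : ℕ} (A : Matrix ι (Idx a b) R) (x : ι) (y : Idx a b) :
    (A * jMat R a b) x y = A x (idxRev y) := by
  have h : ∀ z : Idx a b, (y = idxRev z) ↔ (z = idxRev y) := fun z =>
    ⟨fun h => by rw [h, idxRev_idxRev], fun h => by rw [h, idxRev_idxRev]⟩
  simp [jMat, Matrix.mul_apply, h]

theorem jMat_mul_jMat (a b : ℕ) : jMat R a b * jMat R a b = 1 := by
  ext x y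
  rw [jMat_mul_apply]
  simp [jMat, idxRev_idxRev, Matrix.one_apply, eq_comm]

theorem jMat_transpose (a b : ℕ) : (jMat R a b)ᵀ = jMat R a b := by
  have h := jMat_mul_jMat (R := R) a b
  ext x y
  have e : (x = idxRev y) ↔ (y = idxRev x) :=
    ⟨fun h => by rw [h, idxRev_idxRev], fun h => by rw [h, idxRev_idxRev]⟩
  simp [jMat, e]

theorem JMat_mul_JMat (a b : ℕ) : JMat R a b * JMat R a b = -1 := by
  rw [JMat, fromBlocks_multiply, ← fromBlocks_one, fromBlocks_neg]
  simp [jMat_mul_jMat]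

end Algebra

/-- The symplectic group `G_{ab} = Sp_{2ab} = {g ∈ GL_{2ab} : ᵗg J g = J}`. -/
def Sp (a b : ℕ) (R : Type*) [CommRing R] : Subgroup (GL (Idx a b ⊕ Idx a b) R) where
  carrier := {g | (g : Matrix _ _ R)ᵀ * JMat R a b * (g : Matrix _ _ R) = JMat R a b}
  one_mem' := by simp
  mul_mem' := by
    intro g h hg hh
    simp only [Set.mem_ofPred_eq, Units.val_mul, transpose_mul] at *
    calc _ = (h : Matrix _ _ R)ᵀ * ((g : Matrix _ _ R)ᵀ * JMat R a b * (g : Matrix _ _ R)) *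
          (h : Matrix _ _ R) := by simp only [Matrix.mul_assoc]
      _ = _ := by rw [hg, hh]
  inv_mem' := by
    intro g hg
    simp only [Set.mem_ofPred_eq] at *
    have h1 : (g : Matrix _ _ R) * ((g⁻¹ : GL (Idx a b ⊕ Idx a b) R) : Matrix (Idx a b ⊕ Idx a b) (Idx a b ⊕ Idx a b) R) = 1 := by
      rw [← Units.val_mul]; simp
    have h2 : ((g⁻¹ : GL (Idx a b ⊕ Idx a b) R) : Matrix (Idx a b ⊕ Idx a b) (Idx a b ⊕ Idx a b) R)ᵀ * (g : Matrix _ _ R)ᵀ = 1 := by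
      rw [← transpose_mul, h1, transpose_one]
    calc _ = ((g⁻¹ : GL (Idx a b ⊕ Idx a b) R) : Matrix (Idx a b ⊕ Idx a b) (Idx a b ⊕ Idx a b) R)ᵀ *
          ((g : Matrix _ _ R)ᵀ * JMat R a b * (g : Matrix _ _ R)) *
          ((g⁻¹ : GL (Idx a b ⊕ Idx a b) R) : Matrix (Idx a b ⊕ Idx a b) (Idx a b ⊕ Idx a b) R) := by rw [hg]
      _ = (((g⁻¹ : GL (Idx a b ⊕ Idx a b) R) : Matrix (Idx a b ⊕ Idx a b) (Idx a b ⊕ Idx a b) R)ᵀ * (g : Matrix _ _ R)ᵀ) * JMat R a b *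
          ((g : Matrix _ _ R) * ((g⁻¹ : GL (Idx a b ⊕ Idx a b) R) : Matrix (Idx a b ⊕ Idx a b) (Idx a b ⊕ Idx a b) R)) := by
        simp only [Matrix.mul_assoc]
      _ = _ := by rw [h1, h2, Matrix.one_mul, Matrix.mul_one]

section Elements

variable {R : Type*} [CommRing R] {a b c : ℕ}

/-- A matrix `M` with `ᵗM J M = J`, as an element of the symplectic group. -/
def spMk (M : Matrix (Idx a b ⊕ Idx a b) (Idx a b ⊕ Idx a b) R)
    (h : Mᵀ * JMat R a b * M = JMat R a b) : Sp a b R :=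
  have h1 : (-(JMat R a b * Mᵀ * JMat R a b)) * M = 1 := by
    rw [Matrix.neg_mul, Matrix.mul_assoc, Matrix.mul_assoc, ← Matrix.mul_assoc Mᵀ, h,
      JMat_mul_JMat, neg_neg]
  ⟨⟨M, -(JMat R a b * Mᵀ * JMat R a b), mul_eq_one_comm.mp h1, h1⟩, h⟩

/-- Underlying matrix of an element of the symplectic group. -/
abbrev spMat (g : Sp a b R) : Matrix (Idx a b ⊕ Idx a b) (Idx a b ⊕ Idx a b) R :=
  ((g : GL (Idx a b ⊕ Idx a b) R) : Matrix _ _ R)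

theorem spMat_mk (M : Matrix (Idx a b ⊕ Idx a b) (Idx a b ⊕ Idx a b) R)
    (h : Mᵀ * JMat R a b * M = JMat R a b) : spMat (spMk M h) = M := rfl

theorem spMat_prop (g : Sp a b R) : (spMat g)ᵀ * JMat R a b * spMat g = JMat R a b := g.2

/-- `m̃ = j ᵗm⁻¹ j`. -/
def tildeMat (m : GL (Idx a b) R) : Matrix (Idx a b) (Idx a b) R :=
  jMat R a b * ((m⁻¹ : GL (Idx a b) R) : Matrix (Idx a b) (Idx a b) R)ᵀ * jMat R a b

theorem leviSp_aux (m : GL (Idx a b) R) :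
    (fromBlocks (m : Matrix (Idx a b) (Idx a b) R) 0 0 (tildeMat m))ᵀ * JMat R a b *
      (fromBlocks (m : Matrix (Idx a b) (Idx a b) R) 0 0 (tildeMat m)) = JMat R a b := by
  have h1 : (m : Matrix (Idx a b) (Idx a b) R) * ((m⁻¹ : GL (Idx a b) R) : Matrix (Idx a b) (Idx a b) R) = 1 := by
    rw [← Units.val_mul]; simp
  have h1' : ((m⁻¹ : GL (Idx a b) R) : Matrix (Idx a b) (Idx a b) R) * (m : Matrix (Idx a b) (Idx a b) R) = 1 := by
    rw [← Units.val_mul]; simp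
  have h2 : (m : Matrix (Idx a b) (Idx a b) R)ᵀ * ((m⁻¹ : GL (Idx a b) R) : Matrix (Idx a b) (Idx a b) R)ᵀ = 1 := by
    rw [← transpose_mul, h1', transpose_one]
  have jj := jMat_mul_jMat (R := R) a b
  have e1 : (m : Matrix (Idx a b) (Idx a b) R)ᵀ * jMat R a b * tildeMat m = jMat R a b := by
    calc _ = (m : Matrix (Idx a b) (Idx a b) R)ᵀ * (jMat R a b * jMat R a b) *
          ((m⁻¹ : GL (Idx a b) R) : Matrix (Idx a b) (Idx a b) R)ᵀ * jMat R a b := by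
          simp only [tildeMat, Matrix.mul_assoc]
      _ = _ := by rw [jj, Matrix.mul_one, h2, Matrix.one_mul]
  have e2 : (tildeMat m)ᵀ * jMat R a b * (m : Matrix (Idx a b) (Idx a b) R) = jMat R a b := by
    calc _ = jMat R a b * ((m⁻¹ : GL (Idx a b) R) : Matrix (Idx a b) (Idx a b) R) * (jMat R a b * jMat R a b) *
          (m : Matrix (Idx a b) (Idx a b) R) := by
          simp only [tildeMat, transpose_mul, transpose_transpose, jMat_transpose,
            Matrix.mul_assoc]
      _ = _ := by rw [jj, Matrix.mul_one, Matrix.mul_assoc, h1', Matrix.mul_one]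
  rw [JMat, fromBlocks_transpose, fromBlocks_multiply, fromBlocks_multiply]
  simp only [transpose_zero, Matrix.zero_mul, Matrix.mul_zero, zero_add, add_zero,
    Matrix.mul_neg, Matrix.neg_mul, neg_zero, e1, e2]

/-- The Siegel Levi subgroup: `m ↦ diag(m, m̃)`. -/
def leviSp (m : GL (Idx a b) R) : Sp a b R :=
  spMk (fromBlocks (m : Matrix (Idx a b) (Idx a b) R) 0 0 (tildeMat m)) (leviSp_aux m)

/-- The general `ab × ab` matrix symmetric around the second diagonal, `Y = S j` with `S`
symmetric; the entries `y s(x, x')` of `S` are free coordinates, one for each unordered pair. -/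
def persym (y : Sym2 (Idx a b) → R) : Matrix (Idx a b) (Idx a b) R :=
  Matrix.of fun x x' => y s(x, idxRev x')

theorem siegelN_aux (y : Sym2 (Idx a b) → R) :
    (fromBlocks 1 (persym y) 0 1)ᵀ * JMat R a b * (fromBlocks 1 (persym y) 0 1) =
      JMat R a b := by
  rw [JMat, fromBlocks_transpose, fromBlocks_multiply, fromBlocks_multiply]
  have e : (persym y)ᵀ * jMat R a b - jMat R a b * persym y = 0 := by
    ext x x'
    rw [Matrix.sub_apply, mul_jMat_apply, jMat_mul_apply]
    simp [persym, Sym2.eq_swap]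
  have e' : -(jMat R a b * persym y) + (persym y)ᵀ * jMat R a b = 0 := by
    rw [← e]; abel
  simp [e']

/-- The unipotent radical `N^{ab}_{ab}` of the Siegel parabolic: `n(Y) = (1, Y; 0, 1)`. -/
def siegelN (y : Sym2 (Idx a b) → R) : Sp a b R :=
  spMk (fromBlocks 1 (persym y) 0 1) (siegelN_aux y)

/-- The long Weyl element `w₀ = (0, 1; -1, 0)`. -/
def w0 (R : Type*) [CommRing R] (a b : ℕ) : Sp a b R :=
  spMk (fromBlocks 0 1 (-1) 0) (by
    rw [JMat, fromBlocks_transpose, fromBlocks_multiply, fromBlocks_multiply]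
    simp)

/-- Block `0` followed by the blocks `1, …, c`: `ab = a + ac` for `b = c + 1`. -/
def splitFirst (a c : ℕ) : Fin a ⊕ Idx a c ≃ Idx a (c + 1) where
  toFun := Sum.elim (fun p => (p, 0)) (fun x => (x.1, x.2.succ))
  invFun x := Fin.cases (motive := fun _ => Fin a ⊕ Idx a c) (Sum.inl x.1)
    (fun i => Sum.inr (x.1, i)) x.2
  left_inv := by rintro (p | ⟨p, i⟩) <;> simp
  right_inv := by
    rintro ⟨p, i⟩
    induction i using Fin.cases <;> simp

/-- Blocks `0, …, c - 1` followed by block `c`: `ab = ac + a` for `b = c + 1`. -/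
def splitLast (a c : ℕ) : Idx a c ⊕ Fin a ≃ Idx a (c + 1) where
  toFun := Sum.elim (fun x => (x.1, x.2.castSucc)) (fun p => (p, Fin.last c))
  invFun x := Fin.lastCases (motive := fun _ => Idx a c ⊕ Fin a) (Sum.inr x.1)
    (fun i => Sum.inl (x.1, i)) x.2
  left_inv := by rintro (⟨p, i⟩ | p) <;> simp
  right_inv := by
    rintro ⟨p, i⟩
    induction i using Fin.lastCases <;> simp

/-- Four blocks of sizes `a, a(b-1), a(b-1), a`, where `b = c + 1`. -/
def four (a c : ℕ) :
    (Fin a ⊕ Idx a c) ⊕ (Idx a c ⊕ Fin a) ≃ Idx a (c + 1) ⊕ Idx a (c + 1) :=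
  Equiv.sumCongr (splitFirst a c) (splitLast a c)

/-- Four blocks of sizes `a(b-1), a, a, a(b-1)`, where `b = c + 1`. -/
def four' (a c : ℕ) :
    (Idx a c ⊕ Fin a) ⊕ (Fin a ⊕ Idx a c) ≃ Idx a (c + 1) ⊕ Idx a (c + 1) :=
  Equiv.sumCongr (splitLast a c) (splitFirst a c)

/-- The matrix `j` of size `a`. -/
def jSmall (R : Type*) [Zero R] [One R] (a : ℕ) : Matrix (Fin a) (Fin a) R :=
  Matrix.of fun p q => if q = p.rev then 1 else 0

theorem idxRev_splitFirst (z : Fin a ⊕ Idx a c) : idxRev (splitFirst a c z) =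
    splitLast a c (Sum.elim (fun p => Sum.inr p.rev) (fun x => Sum.inl (idxRev x)) z) := by
  rcases z with p | x <;> simp [splitFirst, splitLast, idxRev, Fin.rev_succ]

theorem idxRev_splitLast (z : Idx a c ⊕ Fin a) : idxRev (splitLast a c z) =
    splitFirst a c (Sum.elim (fun x => Sum.inr (idxRev x)) (fun p => Sum.inl p.rev) z) := by
  rcases z with x | p <;> simp [splitFirst, splitLast, idxRev, Fin.rev_castSucc]

/-- `j_{ab}` in the row blocks `a, a(b-1)` and the column blocks `a(b-1), a`. -/
theorem jMat_split : (jMat R a (c + 1)).submatrix (splitFirst a c) (splitLast a c) =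
    fromBlocks 0 (jSmall R a) (jMat R a c) 0 := by
  ext x y
  rcases x with x | x <;> rcases y with y | y <;>
    simp [jMat, jSmall, idxRev_splitFirst]

theorem jMat_split' : (jMat R a (c + 1)).submatrix (splitLast a c) (splitFirst a c) =
    fromBlocks 0 (jMat R a c) (jSmall R a) 0 := by
  ext x y
  rcases x with x | x <;> rcases y with y | y <;>
    simp [jMat, jSmall, idxRev_splitLast]

theorem JMat_four : (JMat R a (c + 1)).submatrix (four a c) (four a c) =
    fromBlocks 0 (fromBlocks 0 (jSmall R a) (jMat R a c) 0)
      (-fromBlocks 0 (jMat R a c) (jSmall R a) 0) 0 := by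
  rw [← jMat_split, ← jMat_split']
  ext x y
  rcases x with x | x <;> rcases y with y | y <;> simp [JMat, four]

theorem JMat_four' : (JMat R a (c + 1)).submatrix (four' a c) (four' a c) =
    fromBlocks 0 (fromBlocks 0 (jMat R a c) (jSmall R a) 0)
      (-fromBlocks 0 (jSmall R a) (jMat R a c) 0) 0 := by
  rw [← jMat_split, ← jMat_split']
  ext x y
  rcases x with x | x <;> rcases y with y | y <;> simp [JMat, four']

theorem jSmall_mul_apply {ι : Type*} (A : Matrix (Fin a) ι R) (x : Fin a) (y : ι) :
    (jSmall R a * A) x y = A x.rev y := by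
  simp [jSmall, Matrix.mul_apply]

theorem mul_jSmall_apply {ι : Type*} (A : Matrix ι (Fin a) R) (x : ι) (y : Fin a) :
    (A * jSmall R a) x y = A x y.rev := by
  have h : ∀ z : Fin a, (y = z.rev) ↔ (z = y.rev) := fun z =>
    ⟨fun h => by rw [h, Fin.rev_rev], fun h => by rw [h, Fin.rev_rev]⟩
  simp [jSmall, Matrix.mul_apply, h]

theorem jSmall_mul_jSmall : jSmall R a * jSmall R a = 1 := by
  ext x y
  rw [jSmall_mul_apply]
  simp [jSmall, Matrix.one_apply, eq_comm]

/-- Membership in the symplectic group of a matrix written in blocks, the rows being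
decomposed along `e` and the columns along `e'`. -/
theorem block_aux {ι κ : Type*} [Fintype ι] [Fintype κ]
    (e : ι ≃ Idx a b ⊕ Idx a b) (e' : κ ≃ Idx a b ⊕ Idx a b) (N : Matrix ι κ R)
    (h : Nᵀ * (JMat R a b).submatrix e e * N = (JMat R a b).submatrix e' e') :
    (N.submatrix e.symm e'.symm)ᵀ * JMat R a b * N.submatrix e.symm e'.symm = JMat R a b := by
  have h1 : JMat R a b = ((JMat R a b).submatrix e e).submatrix e.symm e.symm := by simp
  conv_lhs => rw [h1]
  rw [transpose_submatrix, submatrix_mul_equiv, submatrix_mul_equiv, h]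
  simp

/-- In blocks of sizes `a, a(b-1), a(b-1), a`, the matrix `diag(1_a, g', 1_a)`. -/
def iMat (g : Sp a c R) :
    Matrix ((Fin a ⊕ Idx a c) ⊕ (Idx a c ⊕ Fin a)) ((Fin a ⊕ Idx a c) ⊕ (Idx a c ⊕ Fin a)) R :=
  fromBlocks
    (fromBlocks 1 0 0 (spMat g).toBlocks₁₁) (fromBlocks 0 0 (spMat g).toBlocks₁₂ 0)
    (fromBlocks 0 (spMat g).toBlocks₂₁ 0 0) (fromBlocks (spMat g).toBlocks₂₂ 0 0 1)

theorem iMat_aux (g : Sp a c R) :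
    (iMat g)ᵀ * (JMat R a (c + 1)).submatrix (four a c) (four a c) * iMat g =
      (JMat R a (c + 1)).submatrix (four a c) (four a c) := by
  have hg := spMat_prop g
  rw [← fromBlocks_toBlocks (spMat g), JMat, fromBlocks_transpose, fromBlocks_multiply,
    fromBlocks_multiply, fromBlocks_inj] at hg
  obtain ⟨h1, h2, h3, h4⟩ := hg
  simp only [Matrix.mul_zero, Matrix.mul_neg, Matrix.neg_mul, zero_add, add_zero] at h1 h2 h3 h4
  rw [JMat_four]
  simp only [iMat, fromBlocks_transpose, fromBlocks_multiply, fromBlocks_neg, transpose_zero,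
    transpose_one, Matrix.mul_zero, Matrix.zero_mul, Matrix.mul_neg, Matrix.neg_mul, zero_add,
    add_zero, fromBlocks_add, Matrix.mul_one, Matrix.one_mul, neg_zero]
  rw [← fromBlocks_zero, ← fromBlocks_zero, fromBlocks_inj, fromBlocks_inj, fromBlocks_inj, fromBlocks_inj, fromBlocks_inj]
  simp [h1, h2, h3, h4]

/-- The embedding `i : G_{a(b-1)} → G_{ab}`, `g' ↦ diag(1_a, g', 1_a)`. -/
def iEmb (g : Sp a c R) : Sp a (c + 1) R :=
  spMk ((iMat g).submatrix (four a c).symm (four a c).symm) (block_aux _ _ _ (iMat_aux g))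

/-- In blocks of sizes `a, a(b-1), a(b-1), a`, the matrix
`v''(X, Z) = (1, X, 0, Z; 0, 1, 0, 0; 0, 0, 1, X'; 0, 0, 0, 1)` with `X' = -j ᵗX j`, where `Z`
is symmetric around the second diagonal: `Z = S j` with `S` symmetric with coordinates `z`. -/
def vMat (X : Fin a × Idx a c → R) (z : Sym2 (Fin a) → R) :
    Matrix ((Fin a ⊕ Idx a c) ⊕ (Idx a c ⊕ Fin a)) ((Fin a ⊕ Idx a c) ⊕ (Idx a c ⊕ Fin a)) R :=
  let Xm : Matrix (Fin a) (Idx a c) R := Matrix.of fun p x => X (p, x)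
  let Zm : Matrix (Fin a) (Fin a) R := Matrix.of fun p q => z s(p, q.rev)
  fromBlocks
    (fromBlocks 1 Xm 0 1) (fromBlocks 0 Zm 0 0)
    0 (fromBlocks 1 (-(jMat R a c * Xmᵀ * jSmall R a)) 0 1)

theorem vMat_aux (X : Fin a × Idx a c → R) (z : Sym2 (Fin a) → R) :
    (vMat X z)ᵀ * (JMat R a (c + 1)).submatrix (four a c) (four a c) * vMat X z =
      (JMat R a (c + 1)).submatrix (four a c) (four a c) := by
  rw [JMat_four]
  let Xm : Matrix (Fin a) (Idx a c) R := Matrix.of fun p x => X (p, x)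
  let Zm : Matrix (Fin a) (Fin a) R := Matrix.of fun p q => z s(p, q.rev)
  change (fromBlocks
    (fromBlocks 1 Xm 0 1) (fromBlocks 0 Zm 0 0)
    0 (fromBlocks 1 (-(jMat R a c * Xmᵀ * jSmall R a)) 0 1))ᵀ * _ * (fromBlocks
    (fromBlocks 1 Xm 0 1) (fromBlocks 0 Zm 0 0)
    0 (fromBlocks 1 (-(jMat R a c * Xmᵀ * jSmall R a)) 0 1)) = _
  have e1 : Zmᵀ * jSmall R a = jSmall R a * Zm := by
    ext x x'
    rw [mul_jSmall_apply, jSmall_mul_apply]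
    simp [Zm, Sym2.eq_swap]
  have e2 : Xmᵀ * jSmall R a = jMat R a c * (jMat R a c * Xmᵀ * jSmall R a) := by
    rw [← Matrix.mul_assoc, ← Matrix.mul_assoc, jMat_mul_jMat, Matrix.one_mul]
  have e3 : jSmall R a * Xm = (jSmall R a * Xm * jMat R a c) * jMat R a c := by
    rw [Matrix.mul_assoc, jMat_mul_jMat, Matrix.mul_one]
  have e4 : (jSmall R a)ᵀ = jSmall R a := by
    ext x y
    have h : (x = y.rev) ↔ (y = x.rev) :=
      ⟨fun h => by rw [h, Fin.rev_rev], fun h => by rw [h, Fin.rev_rev]⟩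
    simp [jSmall, h]
  simp only [fromBlocks_transpose, fromBlocks_multiply, fromBlocks_neg, transpose_zero,
    transpose_one, Matrix.mul_zero, Matrix.zero_mul, Matrix.mul_neg, Matrix.neg_mul, zero_add,
    add_zero, fromBlocks_add, Matrix.mul_one, Matrix.one_mul, neg_zero, transpose_neg,
    transpose_mul, transpose_transpose, jMat_transpose, e4]
  rw [← fromBlocks_zero, fromBlocks_inj, fromBlocks_inj, fromBlocks_inj]
  simp [e1, ← Matrix.mul_assoc, jMat_mul_jMat, Matrix.mul_assoc _ (jMat R a c) (jMat R a c)]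

/-- The elements `v''(X, Z)` of `G_{ab}`. -/
def vTwo (X : Fin a × Idx a c → R) (z : Sym2 (Fin a) → R) : Sp a (c + 1) R :=
  spMk ((vMat X z).submatrix (four a c).symm (four a c).symm) (block_aux _ _ _ (vMat_aux X z))

/-- The matrix `ŵ = (0, 1, 0, 0; 0, 0, 0, 1; -1, 0, 0, 0; 0, 0, 1, 0)`, with rows in blocks of
sizes `a(b-1), a, a, a(b-1)` and columns in blocks of sizes `a, a(b-1), a(b-1), a`. -/
def wHatMat (R : Type*) [CommRing R] (a c : ℕ) :
    Matrix ((Idx a c ⊕ Fin a) ⊕ (Fin a ⊕ Idx a c)) ((Fin a ⊕ Idx a c) ⊕ (Idx a c ⊕ Fin a)) R :=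
  fromBlocks
    (fromBlocks 0 1 0 0) (fromBlocks 0 0 0 1)
    (fromBlocks (-1) 0 0 0) (fromBlocks 0 0 1 0)

theorem wHatMat_aux : (wHatMat R a c)ᵀ * (JMat R a (c + 1)).submatrix (four' a c) (four' a c) *
    wHatMat R a c = (JMat R a (c + 1)).submatrix (four a c) (four a c) := by
  rw [JMat_four, JMat_four']
  simp [wHatMat, fromBlocks_transpose, fromBlocks_multiply, fromBlocks_neg, fromBlocks_add]

/-- The element `ŵ` of `G_{ab}`. -/
def wHat (R : Type*) [CommRing R] (a c : ℕ) : Sp a (c + 1) R :=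
  spMk ((wHatMat R a c).submatrix (four' a c).symm (four a c).symm)
    (block_aux _ _ _ wHatMat_aux)

end Elements

section Induced

variable {F : Type*} [NontriviallyNormedField F] [ProperSpace F]
variable {H : Type*} [NormedAddCommGroup H] [InnerProductSpace ℂ H]
variable {a b c : ℕ}

/-- The block diagonal embedding of the Levi subgroup, `(t₁, …, t_b) ↦ diag(t₁, …, t_b)`. -/
def blockGL (R : Type*) [CommRing R] (a b : ℕ) : (Fin b → GL (Fin a) R) →* GL (Idx a b) R :=
  (Units.map (blockDiagonalRingHom (Fin a) (Fin b) R : _ →* _)).comp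
    (MulEquiv.piUnits (M := fun _ : Fin b => Matrix (Fin a) (Fin a) R)).symm.toMonoidHom

/-- The normalized absolute value of `F`: the module of multiplication by `x`. -/
noncomputable def absF (x : Fˣ) : ℝ := (distribHaarChar F x : ℝ)

/-- `|det m|` for the normalized absolute value. -/
noncomputable def detAbs {n : Type*} [Fintype n] [DecidableEq n] (m : GL n F) : ℝ :=
  absF (Matrix.GeneralLinearGroup.det m)

/-- `|t|^lam = ∏ i, |det t_i|^(lam_i)`. -/
noncomputable def multiAbs (t : Fin b → GL (Fin a) F) (lam : Fin b → ℂ) : ℂ :=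
  ∏ i, ((detAbs (t i) : ℝ) : ℂ) ^ lam i

/-- `Λ_b = ((b-1)/2, (b-3)/2, …, (1-b)/2)`. -/
noncomputable def Lam (b : ℕ) (i : Fin b) : ℂ := ((b : ℂ) - 1) / 2 - (i : ℕ)

/-- Half sum of positive roots for the parabolic `P_{a^b}` of `GL_{ab}`:
`(a(b-1)/2, a(b-3)/2, …, a(1-b)/2)`. -/
noncomputable def rhoGL (a b : ℕ) (i : Fin b) : ℂ := (a : ℂ) * (((b : ℂ) - 1) / 2 - (i : ℕ))

/-- Half sum of positive roots for the parabolic `P_{a^b}` of `G_{ab}`: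
`(a(b-1/2)+1/2, a(b-3/2)+1/2, …, (a+1)/2)`. -/
noncomputable def rhoSp (a b : ℕ) (i : Fin b) : ℂ :=
  (a : ℂ) * ((b : ℂ) - (i : ℕ) - 1 / 2) + 1 / 2

/-- The exponent `(ab+1)/2` of `δ^{1/2}` for the Siegel parabolic of `G_{ab}`. -/
noncomputable def rhoSiegel (a b : ℕ) : ℂ := ((a : ℂ) * (b : ℂ) + 1) / 2

/-- The unipotent radical of the parabolic `P_{a^b}` of `GL_{ab}`: block upper triangular,
with identity blocks on the diagonal. -/
def IsUnipGL (n : GL (Idx a b) F) : Prop :=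
  ∀ x y : Idx a b, y.2 ≤ x.2 →
    (n : Matrix (Idx a b) (Idx a b) F) x y = (1 : Matrix (Idx a b) (Idx a b) F) x y

/-- The number of the block of size `a` that a coordinate of `F^{2ab}` belongs to. -/
def blockNo (x : Idx a b ⊕ Idx a b) : ℕ :=
  Sum.elim (fun x => (x.2 : ℕ)) (fun x => b + (x.2 : ℕ)) x

/-- The unipotent radical of the parabolic `P_{a^b}` of `G_{ab}`: block upper triangular for
the `2b` blocks of size `a`, with identity blocks on the diagonal. -/
def IsUnipSp (u : Sp a b F) : Prop :=
  ∀ x y : Idx a b ⊕ Idx a b, blockNo y ≤ blockNo x →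
    spMat u x y = (1 : Matrix (Idx a b ⊕ Idx a b) (Idx a b ⊕ Idx a b) F) x y

/-- The (normalized) induced representation `Ind_{P_{a^b}}^{GL_{ab}}(π, lam)`: continuous
`f : GL_{ab}(F) → H` with `f(n t m) = |t|^{lam + ρ} π(t) f(m)`, where `π` is a unitary
representation of the Levi subgroup `GL_a(F)^b`. -/
def indGL (pi : (Fin b → GL (Fin a) F) →* (H ≃ₗᵢ[ℂ] H)) (lam : Fin b → ℂ) :
    Submodule ℂ (GL (Idx a b) F → H) where
  carrier := {f | Continuous f ∧ (∀ n m, IsUnipGL n → f (n * m) = f m) ∧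
    ∀ t m, f (blockGL F a b t * m) = multiAbs t (lam + rhoGL a b) • pi t (f m)}
  zero_mem' := ⟨continuous_const, by simp, by simp⟩
  add_mem' := by
    rintro f g ⟨h1, h2, h3⟩ ⟨h1', h2', h3'⟩
    refine ⟨h1.add h1', fun n m hn => ?_, fun t m => ?_⟩
    · simp [h2 n m hn, h2' n m hn]
    · simp [h3, h3']
  smul_mem' := by
    rintro z f ⟨h1, h2, h3⟩
    refine ⟨h1.const_smul z, fun n m hn => ?_, fun t m => ?_⟩
    · simp [h2 n m hn]
    · simp [h3, smul_comm z]

/-- The (normalized) induced representation `Ind_{P_{a^b}}^{G_{ab}}(π, lam)`: continuous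
`Φ : G_{ab}(F) → H` with `Φ(u m(t) g) = |t|^{lam + ρ} π(t) Φ(g)`.  (Smooth and `K`-finite
sections are among the continuous ones.) -/
def indSp (pi : (Fin b → GL (Fin a) F) →* (H ≃ₗᵢ[ℂ] H)) (lam : Fin b → ℂ) :
    Submodule ℂ (Sp a b F → H) where
  carrier := {f | Continuous f ∧ (∀ u g, IsUnipSp u → f (u * g) = f g) ∧
    ∀ t g, f (leviSp (blockGL F a b t) * g) = multiAbs t (lam + rhoSp a b) • pi t (f g)}
  zero_mem' := ⟨continuous_const, by simp, by simp⟩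
  add_mem' := by
    rintro f g ⟨h1, h2, h3⟩ ⟨h1', h2', h3'⟩
    refine ⟨h1.add h1', fun n m hn => ?_, fun t m => ?_⟩
    · simp [h2 n m hn, h2' n m hn]
    · simp [h3, h3']
  smul_mem' := by
    rintro z f ⟨h1, h2, h3⟩
    refine ⟨h1.const_smul z, fun n m hn => ?_, fun t m => ?_⟩
    · simp [h2 n m hn]
    · simp [h3, smul_comm z]

/-- The representation `Ind_P^{G_{ab}}(Δ, s)` induced from the Siegel parabolic, for a
representation `Δ` of `GL_{ab}(F)` on a space of functions on `GL_{ab}(F)`.  A section `φ`, with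
`φ(u m g; r) = |det m|^{s+ρ} φ(g; r m)` and `φ(g; ·) ∈ Δ`, is given by the function
`Φ(g) = φ(g; 1)`, from which `φ(g; r) = |det r|^{-s-ρ} Φ(m(r) g)` is recovered. -/
def indSiegel (Del : Submodule ℂ (GL (Idx a b) F → H)) (s : ℂ) :
    Submodule ℂ (Sp a b F → H) where
  carrier := {f | Continuous f ∧ (∀ y g, f (siegelN y * g) = f g) ∧
    ∀ g, (fun r : GL (Idx a b) F =>
      ((detAbs r : ℝ) : ℂ) ^ (-s - rhoSiegel a b) • f (leviSp r * g)) ∈ Del}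
  zero_mem' := ⟨continuous_const, by simp, fun g => by
    convert Del.zero_mem
    simp⟩
  add_mem' := by
    rintro f g ⟨h1, h2, h3⟩ ⟨h1', h2', h3'⟩
    refine ⟨h1.add h1', fun n m => by simp [h2, h2'], fun x => ?_⟩
    convert Del.add_mem (h3 x) (h3' x)
    simp
  smul_mem' := by
    rintro z f ⟨h1, h2, h3⟩
    refine ⟨h1.const_smul z, fun n m => by simp [h2], fun x => ?_⟩
    convert Del.smul_mem z (h3 x)
    simp [smul_comm z]

/-- The representation of `GL_a(F)^{b-1}` obtained from a representation of `GL_a(F)^b`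
by restriction to the first `b - 1` factors (`b = c + 1`). -/
def restrictFirst (pi : (Fin (c + 1) → GL (Fin a) F) →* (H ≃ₗᵢ[ℂ] H)) :
    (Fin c → GL (Fin a) F) →* (H ≃ₗᵢ[ℂ] H) :=
  pi.comp
    { toFun := fun t => Fin.snoc (α := fun _ => GL (Fin a) F) t 1
      map_one' := by
        ext i : 1
        induction i using Fin.lastCases <;> simp
      map_mul' := by
        intro t t'
        ext i : 1
        induction i using Fin.lastCases <;> simp }

variable [MeasurableSpace F]

/-- The restriction `(i^* Φ)(g') = Φ(i(g'))`. -/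
def iStar (Φ : Sp a (c + 1) F → H) : Sp a c F → H := fun g => Φ (iEmb g)

/-- The integrand `n ↦ Φ(w₀ n g)` of `M^{ab}_{ab}`. -/
def integrandM (Φ : Sp a b F → H) (g : Sp a b F) (y : Sym2 (Idx a b) → F) : H :=
  Φ (w0 F a b * siegelN y * g)

/-- The Haar measure on `N^{ab}_{ab}(F)`: the product of `μ` over the free coordinates. -/
noncomputable def haarN (a b : ℕ) (μ : Measure F) [SigmaFinite μ] :
    Measure (Sym2 (Idx a b) → F) :=
  Measure.pi fun _ => μ

/-- The operator `(M^{ab}_{ab} Φ)(g) = ∫ Φ(w₀ n g) dn`. -/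
noncomputable def opM (μ : Measure F) [SigmaFinite μ] (Φ : Sp a b F → H) : Sp a b F → H :=
  fun g => ∫ y, integrandM Φ g y ∂(haarN a b μ)

/-- The integrand `(X, Z) ↦ Φ(ŵ v''(X, Z) g)` of `U_ŵ`. -/
def integrandU (Φ : Sp a (c + 1) F → H) (g : Sp a (c + 1) F)
    (p : (Fin a × Idx a c → F) × (Sym2 (Fin a) → F)) : H :=
  Φ (wHat F a c * vTwo p.1 p.2 * g)

/-- The measure `dX dZ`: the product of `μ` over the free coordinates of `X` and of `Z`. -/
noncomputable def haarV (a c : ℕ) (μ : Measure F) [SigmaFinite μ] :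
    Measure ((Fin a × Idx a c → F) × (Sym2 (Fin a) → F)) :=
  (Measure.pi fun _ => μ).prod (Measure.pi fun _ => μ)

/-- The operator `(U_ŵ Φ)(g) = ∫∫ Φ(ŵ v''(X, Z) g) dX dZ`. -/
noncomputable def opU (μ : Measure F) [SigmaFinite μ] (Φ : Sp a (c + 1) F → H) :
    Sp a (c + 1) F → H :=
  fun g => ∫ p, integrandU Φ g p ∂(haarV a c μ)

end Induced

set_option linter.unusedSectionVars false

/-! The identity is Fubini's theorem applied to a factorization in the group. Write `Y = (X, Z; Y',
*)` in blocks. Then `w₀ n(Y) = ŵ v''(X, Z) i(w₀' n(Y'))` (`w0_siegelN_eq`), where `w₀'` is the long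
Weyl element of the smaller group. The free coordinates of `Y` are exactly those of `Y'`, `X` and
`Z`, merely relabelled, so the product measures agree without a Jacobian
(`measurePreserving_coordSplit`). Integrating over `(X, Z)` first turns the big intertwining
integral at `i(g')` into the small one of `i^* U_ŵ Φ` at `g'`.

What needs work is absolute convergence, uniformly over archimedean and non-archimedean fields and
for an arbitrary stable `Δ`. The tool is the frame volume: the Haar volume of the coefficient
vectors which the columns of `g⁻¹` in the blocks `0, …, i` send into the unit cube. It is unchanged
by left multiplication by the unipotent radical, is multiplied by `∏_{l ≤ i} |det t_l|` under the
Levi subgroup, and varies by a bounded factor under right translation by a bounded set. With the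
Iwasawa-type decomposition `exists_iwasawa`, this bounds `‖Φ‖` by a product of nonnegative powers of
frame volumes (`exists_norm_le_frameVolR`). The power of the last one grows with `Re s`.

On the elements `w₀ n(Y)` and `ŵ v''(X, Z)` the columns in question contain an identity matrix and,
up to sign, every coordinate. Hence all frame volumes are bounded and the last is `O(1 / max(1,
|y|))` for each coordinate `y`. For large `Re s` the integrand is therefore dominated by `∏ max(1,
|y_j|)^{-2}` (`exists_norm_le_prod_decay`), which is integrable.

The equivariance of `i^* U_ŵ Φ` comes from moving `i(m(h))` and `i(n(Y'))` to the left past `ŵ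
v''(X, Z)`. The first becomes the linear substitution `X ↦ X h`, which produces the shift of
exponents; the second becomes a translation of `Z`. -/

theorem continuous_toLin' {F : Type*} [NontriviallyNormedField F] {ι : Type*} [Fintype ι]
    [DecidableEq ι] (M : Matrix ι ι F) :
    Continuous (Matrix.toLin' M) := LinearMap.continuous_on_pi _

/-! ### The module of a local field, linear changes of variables, and an integrable majorant. -/

section Modulus

open scoped NNReal ENNReal Pointwise

variable {F : Type*} [NontriviallyNormedField F] [ProperSpace F]

/-- The normalized absolute value on all of `F`, with value `0` at `0`. -/
noncomputable def modF (x : F) : ℝ≥0 :=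
  open Classical in if h : x = 0 then 0 else distribHaarChar F (Units.mk0 x h)

theorem modF_zero : modF (0 : F) = 0 := by simp [modF]

theorem modF_coe_units (u : Fˣ) : modF (u : F) = distribHaarChar F u := by
  simp [modF]

theorem modF_one : modF (1 : F) = 1 := by
  simpa using modF_coe_units (1 : Fˣ)

theorem modF_pos {x : F} (hx : x ≠ 0) : 0 < modF x := by
  simp only [modF, hx, dite_false]
  exact distribHaarChar_pos

theorem modF_ne_zero {x : F} (hx : x ≠ 0) : modF x ≠ 0 := (modF_pos hx).ne'

theorem modF_mul (x y : F) : modF (x * y) = modF x * modF y := by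
  by_cases hx : x = 0
  · simp [hx, modF_zero]
  by_cases hy : y = 0
  · simp [hy, modF_zero]
  lift x to Fˣ using isUnit_iff_ne_zero.2 hx
  lift y to Fˣ using isUnit_iff_ne_zero.2 hy
  rw [← Units.val_mul, modF_coe_units, modF_coe_units, modF_coe_units, map_mul]

theorem modF_prod {ι : Type*} (s : Finset ι) (f : ι → F) :
    modF (∏ i ∈ s, f i) = ∏ i ∈ s, modF (f i) := by
  classical
  induction s using Finset.induction_on with
  | empty => simp [modF_one]
  | insert i s hi ih => rw [Finset.prod_insert hi, Finset.prod_insert hi, modF_mul, ih]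

theorem modF_pow (x : F) (n : ℕ) : modF (x ^ n) = modF x ^ n := by
  simpa using modF_prod (Finset.range n) fun _ => x

theorem absF_eq_modF (u : Fˣ) : absF u = modF (u : F) := by
  rw [modF_coe_units]; rfl

theorem detAbs_eq_modF {n : Type*} [Fintype n] [DecidableEq n] (m : GL n F) :
    detAbs m = modF (m : Matrix n n F).det := by
  rw [detAbs, absF_eq_modF]; rfl

theorem detAbs_pos {n : Type*} [Fintype n] [DecidableEq n] (m : GL n F) : 0 < detAbs m := by
  rw [detAbs_eq_modF]
  refine NNReal.coe_pos.2 (modF_pos ?_)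
  exact ((Matrix.isUnit_iff_isUnit_det _).1 m.isUnit).ne_zero

variable [MeasurableSpace F] [BorelSpace F] (μ : Measure F) [μ.IsAddHaarMeasure]

theorem measure_preimage_mul_left {x : F} (hx : x ≠ 0) (s : Set F) :
    modF x * μ ((x * ·) ⁻¹' s) = μ s := by
  lift x to Fˣ using isUnit_iff_ne_zero.2 hx
  rw [modF_coe_units, distribHaarChar_mul]
  congr 1
  have : ((x : F) * ·) ⁻¹' s = x⁻¹ • s := by
    rw [← Set.preimage_smul]; rfl
  rw [this, smul_inv_smul]

variable {ι : Type*} [Fintype ι]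

theorem smul_map_diagonal_pi [DecidableEq ι] {D : ι → F} (h : det (diagonal D) ≠ 0) :
    modF (det (diagonal D)) •
      Measure.map (toLin' (diagonal D)) (Measure.pi fun _ : ι => μ) = Measure.pi fun _ => μ := by
  refine (Measure.pi_eq fun s hs => ?_).symm
  simp only [det_diagonal, Measure.coe_nnreal_smul_apply, modF_prod]
  rw [Measure.map_apply (continuous_toLin' _).measurable (MeasurableSet.univ_pi hs)]
  have : (Matrix.toLin' (diagonal D) ⁻¹' Set.pi Set.univ fun i : ι => s i) =
      Set.pi Set.univ fun i : ι => (D i * ·) ⁻¹' s i := by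
    ext f
    simp only [Set.mem_univ_pi, Set.mem_preimage, diagonal_toLin', LinearMap.pi_apply,
      LinearMap.smul_apply, LinearMap.coe_proj, smul_eq_mul, Function.eval]
  have B : ∀ i, modF (D i) * μ ((D i * ·) ⁻¹' s i) = μ (s i) := by
    intro i
    have A : D i ≠ 0 := by
      simp only [det_diagonal, Ne] at h
      exact Finset.prod_ne_zero_iff.1 h i (Finset.mem_univ i)
    exact measure_preimage_mul_left μ A _
  rw [this, Measure.pi_pi, ENNReal.ofNNReal_finsetProd, ← Finset.prod_mul_distrib]
  simp only [B]

theorem measurePreserving_transvectionStruct [DecidableEq ι] (t : TransvectionStruct ι F) :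
    MeasurePreserving (toLin' t.toMatrix) (Measure.pi fun _ : ι => μ) (Measure.pi fun _ => μ) := by
  have ht : Measurable (toLin' t.toMatrix) := (continuous_toLin' _).measurable
  refine ⟨ht, ?_⟩
  refine (Measure.pi_eq fun s hs ↦ ?_).symm
  have h2s : MeasurableSet (Set.univ.pi s) := .pi Set.countable_univ fun i _ ↦ hs i
  simp_rw [← Measure.pi_pi, ← lintegral_indicator_one h2s]
  rw [lintegral_map (measurable_one.indicator h2s) ht]
  -- A transvection only adds to coordinate `t.i` a multiple of another coordinate, so integrating
  -- that coordinate first reduces the claim to translation invariance of `μ`.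
  refine lintegral_eq_of_lmarginal_eq {t.i} ((measurable_one.indicator h2s).comp ht)
    (measurable_one.indicator h2s) ?_
  simp_rw [lmarginal_singleton]
  ext x
  cases t with | mk t_i t_j t_hij t_c =>
  simp [transvection, single_mulVec, t_hij.symm, ← Function.update_add,
    lintegral_add_right_eq_self fun xᵢ ↦ Set.indicator (Set.univ.pi s) 1 (Function.update x t_i xᵢ)]

/-- An invertible matrix scales the product Haar measure by the module of its determinant. -/
theorem map_matrix_pi_eq_smul_pi [DecidableEq ι] {M : Matrix ι ι F} (hM : det M ≠ 0) :
    Measure.map (toLin' M) (Measure.pi fun _ : ι => μ) =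
      (modF (det M))⁻¹ • Measure.pi fun _ => μ := by
  refine diagonal_transvection_induction_of_det_ne_zero
    (fun M => Measure.map (toLin' M) (Measure.pi fun _ : ι => μ) =
      (modF (det M))⁻¹ • Measure.pi fun _ => μ) M hM ?_ ?_ ?_
  · intro D hD
    conv_rhs => rw [← smul_map_diagonal_pi μ hD]
    rw [smul_smul, inv_mul_cancel₀ (modF_ne_zero hD), one_smul]
  · intro t
    rw [Matrix.TransvectionStruct.det, modF_one, inv_one, one_smul]
    exact (measurePreserving_transvectionStruct μ t).map_eq
  · intro A B _ _ IHA IHB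
    rw [toLin'_mul, det_mul, LinearMap.coe_comp, ← Measure.map_map
      (continuous_toLin' A).measurable (continuous_toLin' B).measurable, IHB, Measure.map_smul,
      IHA, smul_smul, modF_mul, mul_inv, mul_comm]

theorem measurableEmbedding_toLin' [DecidableEq ι] {M : Matrix ι ι F} (hM : det M ≠ 0) :
    MeasurableEmbedding (toLin' M) := by
  have hu : IsUnit M.det := isUnit_iff_ne_zero.2 hM
  let e : (ι → F) ≃ₜ (ι → F) :=
    { toFun := toLin' M
      invFun := toLin' M⁻¹
      left_inv := fun x => by
        simp [Matrix.nonsing_inv_mul _ hu]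
      right_inv := fun x => by
        simp [Matrix.mul_nonsing_inv _ hu]
      continuous_toFun := continuous_toLin' M
      continuous_invFun := continuous_toLin' _ }
  exact e.measurableEmbedding

theorem measure_preimage_mulVec [DecidableEq ι] {M : Matrix ι ι F} (hM : det M ≠ 0)
    (s : Set (ι → F)) :
    (Measure.pi fun _ : ι => μ) ((M *ᵥ ·) ⁻¹' s) =
      ((modF (det M))⁻¹ : ℝ≥0) * (Measure.pi fun _ : ι => μ) s := by
  have e := measurableEmbedding_toLin' hM
  have h := congrArg (fun m => m s) (map_matrix_pi_eq_smul_pi μ hM)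
  simp only [e.map_apply, Measure.coe_nnreal_smul_apply] at h
  exact h

/-- The set where the absolute value is at most `R` has measure `O(R)`. -/
theorem measure_modF_le (R : ℝ≥0) :
    μ {x : F | modF x ≤ R} ≤ R * μ (Metric.closedBall 0 1) := by
  -- Multiplication by `x` carries the unit ball onto the ball of radius `‖x‖`. It therefore
  -- suffices to exhaust the sublevel set by balls whose radii are at most norms of its own
  -- elements.
  have key : ∀ x : F, modF x * μ (Metric.closedBall (0:F) 1) = μ (Metric.closedBall (0:F) ‖x‖) := by
    intro x
    by_cases hx : x = 0
    · simp [hx, modF_zero]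
    rw [← measure_preimage_mul_left μ hx (Metric.closedBall (0:F) ‖x‖)]
    congr 2
    ext y
    simp [hx]
  by_cases hne : ({x : F | modF x ≤ R}).Nonempty
  swap
  · rw [Set.not_nonempty_iff_eq_empty.1 hne]; simp
  by_cases hbdd : BddAbove ((fun x : F => ‖x‖) '' {x : F | modF x ≤ R})
  · -- a sequence approaching the supremum
    obtain ⟨u, hmono, hu, hmem⟩ := exists_seq_tendsto_sSup (hne.image _) hbdd
    choose x hx hxu using hmem
    set S := sSup ((fun x : F => ‖x‖) '' {x : F | modF x ≤ R})
    by_cases hS : S ∈ (fun x : F => ‖x‖) '' {x : F | modF x ≤ R}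
    · obtain ⟨z, hz, hzS⟩ := hS
      calc μ {x : F | modF x ≤ R} ≤ μ (Metric.closedBall (0:F) ‖z‖) := by
            refine measure_mono fun y hy => ?_
            have : ‖y‖ ≤ S := le_csSup hbdd ⟨y, hy, rfl⟩
            simpa [hzS] using this
        _ = modF z * μ (Metric.closedBall (0:F) 1) := (key z).symm
        _ ≤ _ := by gcongr; exact_mod_cast hz
    · have hsub : {x : F | modF x ≤ R} ⊆ ⋃ n, Metric.closedBall (0:F) (u n) := by
        intro y hy
        have h1 : ‖y‖ ≤ S := le_csSup hbdd ⟨y, hy, rfl⟩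
        have h2 : ‖y‖ < S := lt_of_le_of_ne h1 fun h => hS ⟨y, hy, h⟩
        obtain ⟨n, hn⟩ := (hu.eventually (lt_mem_nhds h2)).exists
        exact Set.mem_iUnion.2 ⟨n, by simpa using hn.le⟩
      refine (measure_mono hsub).trans ?_
      rw [Monotone.measure_iUnion (fun i j hij => Metric.closedBall_subset_closedBall (hmono hij))]
      refine iSup_le fun n => ?_
      rw [← hxu n, ← key]
      gcongr
      exact_mod_cast hx n
  -- Boundedness of the sublevel set need not be proved: if it fails, each ball of radius `n` lies
  -- in a ball of radius `‖z‖` with `modF z ≤ R`, and the same estimate applies.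
  · have hsub : {x : F | modF x ≤ R} ⊆ ⋃ n : ℕ, Metric.closedBall (0:F) n := by
      rw [Metric.iUnion_closedBall_nat]; exact Set.subset_univ _
    refine (measure_mono hsub).trans ?_
    rw [Monotone.measure_iUnion (fun i j hij => Metric.closedBall_subset_closedBall (by exact_mod_cast hij))]
    refine iSup_le fun n => ?_
    rw [not_bddAbove_iff] at hbdd
    obtain ⟨_, ⟨z, hz, rfl⟩, hzn⟩ := hbdd n
    calc μ (Metric.closedBall (0:F) n) ≤ μ (Metric.closedBall (0:F) ‖z‖) :=
          measure_mono (Metric.closedBall_subset_closedBall hzn.le)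
      _ = modF z * μ (Metric.closedBall (0:F) 1) := (key z).symm
      _ ≤ _ := by gcongr; exact_mod_cast hz

/-- The module is a ratio of ball volumes, hence a monotone function of the norm. -/
theorem measurable_modF : Measurable (modF : F → ℝ≥0) := by
  let μ : Measure F := Measure.addHaar
  have key : ∀ x : F, (modF x : ℝ≥0∞) =
      μ (Metric.closedBall (0:F) ‖x‖) / μ (Metric.closedBall (0:F) 1) := by
    intro x
    have h0 : μ (Metric.closedBall (0:F) 1) ≠ 0 :=
      (Metric.measure_closedBall_pos μ _ one_pos).ne'
    have h1 : μ (Metric.closedBall (0:F) 1) ≠ ∞ :=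
      (isCompact_closedBall (0:F) 1).measure_lt_top.ne
    rw [ENNReal.eq_div_iff h0 h1, mul_comm]
    by_cases hx : x = 0
    · simp [hx, modF_zero]
    rw [← measure_preimage_mul_left μ hx (Metric.closedBall (0:F) ‖x‖)]
    congr 2
    ext y
    simp [hx]
  have hm : Monotone fun r : ℝ => μ (Metric.closedBall (0:F) r) := fun r r' h =>
    measure_mono (Metric.closedBall_subset_closedBall h)
  have : Measurable fun x : F => (modF x : ℝ≥0∞) := by
    simp_rw [key]
    exact (hm.measurable.comp measurable_norm).div_const _
  exact measurable_coe_nnreal_ennreal_iff.1 this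

/-- The function `max(1, |x|)^{-2}`. -/
noncomputable def decay (x : F) : ℝ := ((max 1 (modF x) : ℝ≥0) : ℝ)⁻¹ ^ 2

theorem integrable_decay : Integrable (decay : F → ℝ) μ := by
  have hmeas : Measurable (decay : F → ℝ) := by
    unfold decay
    exact ((measurable_const.max (measurable_modF)).coe_nnreal_real.inv).pow_const 2
  refine ⟨hmeas.aestronglyMeasurable, ?_⟩
  have hB : μ (Metric.closedBall (0:F) 1) ≠ ∞ := (isCompact_closedBall (0:F) 1).measure_lt_top.ne
  -- dyadic decomposition
  have hle : ∀ x : F, ‖decay x‖ₑ ≤ ∑' k : ℕ, Set.indicator {x : F | modF x ≤ 2 ^ (k + 1)}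
      (fun _ => ((((4:ℝ≥0) ^ k)⁻¹ : ℝ≥0) : ℝ≥0∞)) x := by
    intro x
    obtain ⟨k, hk1, hk2⟩ : ∃ k : ℕ, (2:ℝ≥0) ^ k ≤ max 1 (modF x) ∧ max 1 (modF x) < 2 ^ (k+1) :=
      exists_nat_pow_near (le_max_left _ _) one_lt_two
    refine le_trans ?_ (ENNReal.le_tsum k)
    rw [Set.indicator_of_mem (show x ∈ {x : F | modF x ≤ 2 ^ (k + 1)} from
      (le_max_right _ _).trans hk2.le)]
    have : decay x = ((((max 1 (modF x))⁻¹ ^ 2 : ℝ≥0)) : ℝ) := by simp [decay]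
    rw [this, NNReal.enorm_eq]
    refine ENNReal.coe_le_coe.2 ?_
    rw [show (4:ℝ≥0) = 2 ^ 2 by norm_num, ← pow_mul, mul_comm, pow_mul, ← inv_pow]
    gcongr
  calc ∫⁻ x, ‖decay x‖ₑ ∂μ ≤ ∫⁻ x, (∑' k : ℕ, Set.indicator {x : F | modF x ≤ 2 ^ (k + 1)}
      (fun _ => ((((4:ℝ≥0) ^ k)⁻¹ : ℝ≥0) : ℝ≥0∞)) x) ∂μ := lintegral_mono hle
    _ = ∑' k : ℕ, ((((4:ℝ≥0) ^ k)⁻¹ : ℝ≥0) : ℝ≥0∞) * μ {x : F | modF x ≤ 2 ^ (k + 1)} := by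
      rw [lintegral_tsum]
      · congr 1; ext k
        rw [lintegral_indicator_const]
        exact measurableSet_le (measurable_modF) measurable_const
      · intro k
        exact (measurable_const.indicator
          (measurableSet_le (measurable_modF) measurable_const)).aemeasurable
    -- The shell `2^k ≤ max(1, |x|) < 2^(k+1)` has measure at most `2^(k+1) μ(B)`, against a value
    -- at most `4^(-k)`.
    _ ≤ ∑' k : ℕ, (((2 * (1 / 2 : ℝ≥0) ^ k) : ℝ≥0) : ℝ≥0∞) * μ (Metric.closedBall (0:F) 1) := by
      refine ENNReal.tsum_le_tsum fun k => ?_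
      refine (mul_le_mul_right (measure_modF_le μ _) _).trans ?_
      rw [← mul_assoc, ← ENNReal.coe_mul]
      refine mul_le_mul_left (ENNReal.coe_le_coe.2 (le_of_eq ?_)) _
      rw [show (4:ℝ≥0) = 2 * 2 by norm_num, mul_pow, pow_succ]
      field_simp
      rw [← mul_pow, mul_one_div_cancel two_ne_zero, one_pow]
    _ < ∞ := by
      rw [ENNReal.tsum_mul_right]
      refine ENNReal.mul_lt_top ?_ hB.lt_top
      have : Summable fun k : ℕ => 2 * (1 / 2 : ℝ≥0) ^ k :=
        (NNReal.summable_geometric (by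
          rw [← NNReal.coe_lt_coe]; norm_num)).mul_left 2
      exact (ENNReal.tsum_coe_ne_top_iff_summable.2 this).lt_top

end Modulus

/-! ### Matrix identities in the symplectic group. -/

section SymplecticAlgebra

variable {R : Type*} [CommRing R] {a b c : ℕ}

theorem spMat_injective : Function.Injective (spMat : Sp a b R → _) := fun _ _ h =>
  Subtype.ext (Units.ext h)

theorem spMat_mul (g h : Sp a b R) : spMat (g * h) = spMat g * spMat h := rfl

theorem spMat_one : spMat (1 : Sp a b R) = 1 := rfl

theorem spMat_mul_inv (g : Sp a b R) : spMat g * spMat g⁻¹ = 1 := by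
  rw [← spMat_mul, mul_inv_cancel, spMat_one]

theorem spMat_inv_mul (g : Sp a b R) : spMat g⁻¹ * spMat g = 1 := by
  rw [← spMat_mul, inv_mul_cancel, spMat_one]

theorem spMat_inv (g : Sp a b R) : spMat g⁻¹ = -(JMat R a b * (spMat g)ᵀ * JMat R a b) := by
  have h1 : (-(JMat R a b * (spMat g)ᵀ * JMat R a b)) * spMat g = 1 := by
    rw [Matrix.neg_mul, Matrix.mul_assoc, Matrix.mul_assoc, ← Matrix.mul_assoc (spMat g)ᵀ,
      spMat_prop, JMat_mul_JMat, neg_neg]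
  calc spMat g⁻¹ = (-(JMat R a b * (spMat g)ᵀ * JMat R a b)) * spMat g * spMat g⁻¹ := by
        rw [h1, Matrix.one_mul]
    _ = _ := by rw [Matrix.mul_assoc, spMat_mul_inv, Matrix.mul_one]

/-- If `spMat g = M * spMat h`, then `M` is the matrix of `g * h⁻¹`. -/
theorem spMat_mul_inv_eq {g h : Sp a b R} {M : Matrix (Idx a b ⊕ Idx a b) (Idx a b ⊕ Idx a b) R}
    (e : spMat g = M * spMat h) : spMat (g * h⁻¹) = M := by
  rw [spMat_mul, e, Matrix.mul_assoc, spMat_mul_inv, Matrix.mul_one]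

theorem spMat_leviSp (m : GL (Idx a b) R) :
    spMat (leviSp m) = fromBlocks (m : Matrix (Idx a b) (Idx a b) R) 0 0 (tildeMat m) := rfl

theorem spMat_siegelN (y : Sym2 (Idx a b) → R) :
    spMat (siegelN y) = fromBlocks 1 (persym y) 0 1 := rfl

theorem tildeMat_mul (m m' : GL (Idx a b) R) : tildeMat (m * m') = tildeMat m * tildeMat m' := by
  have jj := jMat_mul_jMat (R := R) a b
  simp only [tildeMat, _root_.mul_inv_rev, Units.val_mul, transpose_mul]
  calc _ = jMat R a b * ((m⁻¹ : GL (Idx a b) R) : Matrix (Idx a b) (Idx a b) R)ᵀ * 1 *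
        ((m'⁻¹ : GL (Idx a b) R) : Matrix (Idx a b) (Idx a b) R)ᵀ * jMat R a b := by
        simp only [Matrix.mul_assoc, Matrix.one_mul]
    _ = _ := by rw [← jj]; simp only [Matrix.mul_assoc]

theorem leviSp_mul (m m' : GL (Idx a b) R) : leviSp (m * m') = leviSp m * leviSp m' := by
  apply spMat_injective
  rw [spMat_mul, spMat_leviSp, spMat_leviSp, spMat_leviSp, fromBlocks_multiply]
  simp [tildeMat_mul]

theorem leviSp_one : leviSp (1 : GL (Idx a b) R) = 1 := by
  have h := leviSp_mul (1 : GL (Idx a b) R) 1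
  rw [mul_one] at h
  exact left_eq_mul.1 h

theorem persym_add (y y' : Sym2 (Idx a b) → R) : persym (y + y') = persym y + persym y' := by
  ext; simp [persym]

theorem siegelN_add (y y' : Sym2 (Idx a b) → R) : siegelN (y + y') = siegelN y * siegelN y' := by
  apply spMat_injective
  rw [spMat_mul, spMat_siegelN, spMat_siegelN, spMat_siegelN, fromBlocks_multiply]
  simp [persym_add, add_comm]

theorem siegelN_zero : siegelN (0 : Sym2 (Idx a b) → R) = 1 := by
  have h := siegelN_add (0 : Sym2 (Idx a b) → R) 0
  rw [add_zero] at h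
  exact left_eq_mul.1 h

theorem siegelN_neg (y : Sym2 (Idx a b) → R) : siegelN (-y) = (siegelN y)⁻¹ := by
  rw [eq_inv_iff_mul_eq_one, ← siegelN_add, neg_add_cancel, siegelN_zero]

/-- A symplectic matrix fixing the first half of the standard basis lies in the unipotent radical
of the Siegel parabolic. -/
theorem exists_siegelN_of_cols {g : Sp a b R} (h1 : (spMat g).toBlocks₁₁ = 1)
    (h2 : (spMat g).toBlocks₂₁ = 0) : ∃ y, g = siegelN y := by
  have hg := spMat_prop g
  rw [← fromBlocks_toBlocks (spMat g), h1, h2, JMat, fromBlocks_transpose, fromBlocks_multiply,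
    fromBlocks_multiply, fromBlocks_inj] at hg
  obtain ⟨-, e1, -, e2⟩ := hg
  set B := (spMat g).toBlocks₁₂
  set D := (spMat g).toBlocks₂₂
  simp only [transpose_one, transpose_zero, Matrix.mul_zero, Matrix.mul_neg, Matrix.neg_mul,
    Matrix.one_mul, zero_add, add_zero, Matrix.zero_mul, neg_zero] at e1 e2
  have hD : D = 1 := by
    have := congrArg (fun M => jMat R a b * M) e1
    simpa [← Matrix.mul_assoc, jMat_mul_jMat] using this
  rw [hD] at e2
  have e3 : Bᵀ * jMat R a b = jMat R a b * B := by
    rw [transpose_one, Matrix.one_mul, Matrix.mul_one] at e2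
    rw [← sub_eq_zero, ← e2]; abel
  have hsymm : ∀ x x' : Idx a b, B x (idxRev x') = B x' (idxRev x) := by
    intro x x'
    have := congrFun (congrFun e3 (idxRev x)) (idxRev x')
    rw [mul_jMat_apply, jMat_mul_apply, idxRev_idxRev, idxRev_idxRev, transpose_apply] at this
    exact this.symm
  refine ⟨Sym2.lift ⟨fun x x' => B x (idxRev x'), hsymm⟩, ?_⟩
  apply spMat_injective
  rw [← fromBlocks_toBlocks (spMat g), h1, h2, spMat_siegelN, fromBlocks_inj]
  refine ⟨rfl, ?_, rfl, hD⟩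
  ext x x'
  simp [persym, idxRev_idxRev, B]

theorem exists_levi_siegelN_of_cols {g : Sp a b R} (m : GL (Idx a b) R)
    (h1 : (spMat g).toBlocks₁₁ = m) (h2 : (spMat g).toBlocks₂₁ = 0) :
    ∃ y, g = leviSp m * siegelN y := by
  obtain ⟨y, hy⟩ := exists_siegelN_of_cols (g := leviSp m⁻¹ * g)
    (by
      rw [spMat_mul, spMat_leviSp, ← fromBlocks_toBlocks (spMat g), fromBlocks_multiply, h1, h2]
      simp)
    (by
      rw [spMat_mul, spMat_leviSp, ← fromBlocks_toBlocks (spMat g), fromBlocks_multiply, h1, h2]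
      simp)
  refine ⟨y, ?_⟩
  rw [← hy, ← mul_assoc, ← leviSp_mul, mul_inv_cancel, leviSp_one, one_mul]

/-- This makes the vanishing of the lower left block stable under inversion, which yields
invertibility of the upper left block without a determinant argument. -/
theorem spMat_inv_toBlocks₂₁ (g : Sp a b R) : (spMat g⁻¹).toBlocks₂₁ =
    -(jMat R a b * ((spMat g).toBlocks₂₁)ᵀ * jMat R a b) := by
  rw [spMat_inv, ← fromBlocks_toBlocks (spMat g), JMat, fromBlocks_transpose, fromBlocks_multiply,
    fromBlocks_multiply]
  simp [fromBlocks_neg]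

/-- A symplectic matrix stabilizing the span of the first half of the standard basis lies in the
Siegel parabolic. -/
theorem exists_levi_siegelN_of_toBlocks₂₁ {g : Sp a b R} (h2 : (spMat g).toBlocks₂₁ = 0) :
    ∃ (m : GL (Idx a b) R) (y : _), (m : Matrix (Idx a b) (Idx a b) R) = (spMat g).toBlocks₁₁ ∧
      g = leviSp m * siegelN y := by
  have h3 : (spMat g⁻¹).toBlocks₂₁ = 0 := by simp [spMat_inv_toBlocks₂₁, h2]
  have e1 := spMat_mul_inv g
  have e2 := spMat_inv_mul g
  rw [← fromBlocks_toBlocks (spMat g), ← fromBlocks_toBlocks (spMat g⁻¹), fromBlocks_multiply,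
    ← fromBlocks_one, fromBlocks_inj, h3] at e1
  rw [← fromBlocks_toBlocks (spMat g), ← fromBlocks_toBlocks (spMat g⁻¹), fromBlocks_multiply,
    ← fromBlocks_one, fromBlocks_inj, h2] at e2
  let m : GL (Idx a b) R := ⟨(spMat g).toBlocks₁₁, (spMat g⁻¹).toBlocks₁₁,
    by simpa using e1.1, by simpa using e2.1⟩
  obtain ⟨y, hy⟩ := exists_levi_siegelN_of_cols m rfl h2
  exact ⟨m, y, rfl, hy⟩

/-- `diag(h, 1)` in `GL_{ab}` for `h` in `GL_{a(b-1)}`. -/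
def extGL (h : GL (Idx a c) R) : GL (Idx a (c + 1)) R where
  val := (fromBlocks (h : Matrix (Idx a c) (Idx a c) R) 0 0 1).submatrix
    (splitLast a c).symm (splitLast a c).symm
  inv := (fromBlocks ((h⁻¹ : GL (Idx a c) R) : Matrix (Idx a c) (Idx a c) R) 0 0 1).submatrix
    (splitLast a c).symm (splitLast a c).symm
  val_inv := by
    rw [submatrix_mul_equiv, fromBlocks_multiply]
    simp
  inv_val := by
    rw [submatrix_mul_equiv, fromBlocks_multiply]
    simp

/-- The unipotent matrix `(1, T; 0, 1)` in `GL_{ab}`, in blocks of sizes `a(b-1), a`. -/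
def unipLastGL (T : Matrix (Idx a c) (Fin a) R) : GL (Idx a (c + 1)) R where
  val := (fromBlocks 1 T 0 1).submatrix (splitLast a c).symm (splitLast a c).symm
  inv := (fromBlocks 1 (-T) 0 1).submatrix (splitLast a c).symm (splitLast a c).symm
  val_inv := by
    rw [submatrix_mul_equiv, fromBlocks_multiply]
    simp
  inv_val := by
    rw [submatrix_mul_equiv, fromBlocks_multiply]
    simp

/-- Conjugation by `j` reverses the order of the blocks, so the identity block moves from the last
place to the first. -/
theorem tildeMat_extGL (h : GL (Idx a c) R) : tildeMat (extGL h) =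
    (fromBlocks 1 0 0 (tildeMat h)).submatrix (splitFirst a c).symm (splitFirst a c).symm := by
  have e1 : jMat R a (c + 1) = (fromBlocks 0 (jSmall R a) (jMat R a c) 0).submatrix
      (splitFirst a c).symm (splitLast a c).symm := by rw [← jMat_split]; simp
  have e2 : jMat R a (c + 1) = (fromBlocks 0 (jMat R a c) (jSmall R a) 0).submatrix
      (splitLast a c).symm (splitFirst a c).symm := by rw [← jMat_split']; simp
  have e3 : (((extGL h)⁻¹ : GL (Idx a (c + 1)) R) : Matrix (Idx a (c + 1)) (Idx a (c + 1)) R) =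
      (fromBlocks ((h⁻¹ : GL (Idx a c) R) : Matrix (Idx a c) (Idx a c) R) 0 0 1).submatrix
        (splitLast a c).symm (splitLast a c).symm := rfl
  rw [tildeMat, e3]
  conv_lhs =>
    congr
    · rw [e1]
    · rw [e2]
  rw [transpose_submatrix, submatrix_mul_equiv, submatrix_mul_equiv, fromBlocks_transpose,
    fromBlocks_multiply, fromBlocks_multiply]
  simp [tildeMat, jSmall_mul_jSmall]

theorem spMat_leviSp_extGL (h : GL (Idx a c) R) : spMat (leviSp (extGL h)) =
    (fromBlocks (fromBlocks (h : Matrix (Idx a c) (Idx a c) R) 0 0 1) 0 0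
      (fromBlocks 1 0 0 (tildeMat h))).submatrix (four' a c).symm (four' a c).symm := by
  rw [spMat_leviSp, tildeMat_extGL]
  ext x y
  rcases x with x | x <;> rcases y with y | y <;> simp [four', extGL]

theorem iMat_mul (g h : Sp a c R) : iMat (g * h) = iMat g * iMat h := by
  have e : spMat (g * h) = _ := spMat_mul g h
  rw [← fromBlocks_toBlocks (spMat g), ← fromBlocks_toBlocks (spMat h), fromBlocks_multiply] at e
  simp only [iMat, e, toBlocks_fromBlocks₁₁, toBlocks_fromBlocks₁₂, toBlocks_fromBlocks₂₁,
    toBlocks_fromBlocks₂₂]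
  simp [fromBlocks_multiply, fromBlocks_add]

theorem spMat_iEmb (g : Sp a c R) :
    spMat (iEmb g) = (iMat g).submatrix (four a c).symm (four a c).symm := rfl

theorem spMat_wHat : spMat (wHat R a c) =
    (wHatMat R a c).submatrix (four' a c).symm (four a c).symm := rfl

theorem spMat_vTwo (X : Fin a × Idx a c → R) (z : Sym2 (Fin a) → R) : spMat (vTwo X z) =
    (vMat X z).submatrix (four a c).symm (four a c).symm := rfl

theorem iEmb_mul (g h : Sp a c R) : iEmb (g * h) = iEmb g * iEmb h := by
  apply spMat_injective
  rw [spMat_mul, spMat_iEmb, spMat_iEmb, spMat_iEmb, submatrix_mul_equiv, iMat_mul]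

theorem vTwo_add (X X' : Fin a × Idx a c → R) (z z' : Sym2 (Fin a) → R) :
    vTwo (X + X') (z + z') = vTwo X z * vTwo X' z' := by
  apply spMat_injective
  rw [spMat_mul, spMat_vTwo, spMat_vTwo, spMat_vTwo, submatrix_mul_equiv]
  congr 1
  have e1 : (Matrix.of fun p x => (X + X') (p, x)) =
      (Matrix.of fun p x => X (p, x)) + (Matrix.of fun p x => X' (p, x)) := by ext; simp
  have e2 : (Matrix.of fun p (q : Fin a) => (z + z') s(p, q.rev)) =
      (Matrix.of fun p q => z s(p, q.rev)) + (Matrix.of fun p q => z' s(p, q.rev)) := by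
    ext; simp
  simp only [vMat, e1, e2]
  generalize (Matrix.of fun p x => X (p, x)) = A, (Matrix.of fun p x => X' (p, x)) = B
  simp [fromBlocks_multiply, fromBlocks_add, Matrix.mul_add, Matrix.add_mul, add_comm]

theorem vTwo_zero : vTwo (0 : Fin a × Idx a c → R) 0 = 1 := by
  have h := vTwo_add (0 : Fin a × Idx a c → R) 0 0 0
  rw [add_zero, add_zero] at h
  exact left_eq_mul.1 h

theorem vTwo_neg (X : Fin a × Idx a c → R) (z : Sym2 (Fin a) → R) :
    vTwo (-X) (-z) = (vTwo X z)⁻¹ := by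
  rw [eq_inv_iff_mul_eq_one, ← vTwo_add, neg_add_cancel, neg_add_cancel, vTwo_zero]

theorem spMat_wHat_mul_vTwo (X : Fin a × Idx a c → R) (z : Sym2 (Fin a) → R) :
    spMat (wHat R a c * vTwo X z) = (fromBlocks
      (fromBlocks 0 1 0 0) (fromBlocks 0 0 0 1)
      (fromBlocks (-1) (-(Matrix.of fun p x => X (p, x))) 0 0)
      (fromBlocks 0 (-(Matrix.of fun p q => z s(p, q.rev))) 1
        (-(jMat R a c * (Matrix.of fun p x => X (p, x))ᵀ * jSmall R a)))).submatrix
      (four' a c).symm (four a c).symm := by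
  rw [spMat_mul, spMat_wHat, spMat_vTwo, submatrix_mul_equiv, wHatMat, vMat]
  simp [fromBlocks_multiply, fromBlocks_add]

/-- The right action of `h` on the coordinates of `X`. -/
def actX (h : Matrix (Idx a c) (Idx a c) R) (X : Fin a × Idx a c → R) : Fin a × Idx a c → R :=
  fun p => ∑ x, X (p.1, x) * h x p.2

theorem of_actX (h : Matrix (Idx a c) (Idx a c) R) (X : Fin a × Idx a c → R) :
    (Matrix.of fun p x => actX h X (p, x)) = (Matrix.of fun p x => X (p, x)) * h := by
  ext; simp [actX, Matrix.mul_apply]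

/-- `ŵ` moves the second block to the front, so it conjugates `i(m(h))` to `m(diag(h, 1))`; passing
through `v''(X, Z)` leaves `Z` alone and multiplies `X` by `h`. -/
theorem wHat_vTwo_iEmb_leviSp (X : Fin a × Idx a c → R) (z : Sym2 (Fin a) → R)
    (h : GL (Idx a c) R) : wHat R a c * vTwo X z * iEmb (leviSp h) =
      leviSp (extGL h) * (wHat R a c * vTwo (actX h X) z) := by
  apply spMat_injective
  rw [spMat_mul _ (iEmb _), spMat_mul (leviSp _), spMat_wHat_mul_vTwo, spMat_wHat_mul_vTwo,
    spMat_leviSp_extGL,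
    spMat_iEmb, submatrix_mul_equiv, submatrix_mul_equiv, of_actX]
  congr 1
  have e : tildeMat h * (jMat R a c * ((Matrix.of fun p x => X (p, x)) *
      (h : Matrix (Idx a c) (Idx a c) R))ᵀ * jSmall R a) =
      jMat R a c * (Matrix.of fun p x => X (p, x))ᵀ * jSmall R a := by
    have h1 : ((h⁻¹ : GL (Idx a c) R) : Matrix (Idx a c) (Idx a c) R)ᵀ *
        (h : Matrix (Idx a c) (Idx a c) R)ᵀ = 1 := by
      rw [← transpose_mul, ← Units.val_mul]; simp
    rw [tildeMat, transpose_mul]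
    calc _ = jMat R a c * ((h⁻¹ : GL (Idx a c) R) : Matrix (Idx a c) (Idx a c) R)ᵀ *
          (jMat R a c * jMat R a c) * (h : Matrix (Idx a c) (Idx a c) R)ᵀ *
          (Matrix.of fun p x => X (p, x))ᵀ * jSmall R a := by simp only [Matrix.mul_assoc]
      _ = _ := by
        rw [jMat_mul_jMat, Matrix.mul_one, Matrix.mul_assoc (jMat R a c), h1, Matrix.mul_one]
  rw [iMat, spMat_leviSp, toBlocks_fromBlocks₁₁, toBlocks_fromBlocks₁₂, toBlocks_fromBlocks₂₁,
    toBlocks_fromBlocks₂₂]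
  generalize (Matrix.of fun p x => X (p, x)) = A at *
  rw [transpose_mul] at e
  simp [fromBlocks_multiply, e]

/-- The coordinates of the symmetric matrix `X S ᵗX`, where `S` has coordinates `y`. -/
def sandwich (y : Sym2 (Idx a c) → R) (X : Fin a × Idx a c → R) : Sym2 (Fin a) → R :=
  Sym2.lift ⟨fun p q => ∑ x, ∑ x', X (p, x) * y s(x, x') * X (q, x'), fun p q => by
    beta_reduce
    rw [Finset.sum_comm]
    refine Finset.sum_congr rfl fun x _ => Finset.sum_congr rfl fun x' _ => ?_
    rw [Sym2.eq_swap]; ring⟩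

theorem of_sandwich (y : Sym2 (Idx a c) → R) (X : Fin a × Idx a c → R) :
    (Matrix.of fun p (q : Fin a) => sandwich y X s(p, q.rev)) =
      (Matrix.of fun p x => X (p, x)) * persym y *
        (jMat R a c * (Matrix.of fun p x => X (p, x))ᵀ * jSmall R a) := by
  rw [← Matrix.mul_assoc, ← Matrix.mul_assoc, Matrix.mul_assoc _ (persym y)]
  ext p q
  rw [mul_jSmall_apply]
  simp only [Matrix.mul_apply, sandwich, Sym2.lift_mk, of_apply, transpose_apply]
  rw [Finset.sum_comm]
  refine Finset.sum_congr rfl fun x _ => ?_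
  rw [Finset.sum_mul]
  refine Finset.sum_congr rfl fun x' _ => ?_
  rw [← Matrix.mul_apply, mul_jMat_apply]
  simp [persym, idxRev_idxRev]

/-- Modulo unipotent elements of the Siegel Levi subgroup and the Siegel unipotent radical,
right translation of `ŵ v''(X, Z)` by `i(n(Y))` is a translation of `Z`. -/
theorem wHat_vTwo_iEmb_siegelN (X : Fin a × Idx a c → R) (z : Sym2 (Fin a) → R)
    (y : Sym2 (Idx a c) → R) : ∃ (T : Matrix (Idx a c) (Fin a) R) (y' : Sym2 (Idx a (c + 1)) → R),
    wHat R a c * vTwo X z * iEmb (siegelN y) = leviSp (unipLastGL T) * siegelN y' *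
      (wHat R a c * vTwo X (z + sandwich y X)) := by
  let Xm : Matrix (Fin a) (Idx a c) R := Matrix.of fun p x => X (p, x)
  let X' : Matrix (Idx a c) (Fin a) R := jMat R a c * Xmᵀ * jSmall R a
  let T : Matrix (Idx a c) (Fin a) R := persym y * X'
  have e2 : (Matrix.of fun p (q : Fin a) => (z + sandwich y X) s(p, q.rev)) =
      (Matrix.of fun p q => z s(p, q.rev)) + Xm * persym y * X' := by
    rw [← of_sandwich]; ext; simp
  -- The left factor is written down explicitly. That it lies in the Siegel parabolic with Levi part
  -- `(1, T; 0, 1)` is then read off from its first half of columns, so `y'` never has to be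
  -- computed.
  let M : Matrix (Idx a (c + 1) ⊕ Idx a (c + 1)) (Idx a (c + 1) ⊕ Idx a (c + 1)) R :=
    (fromBlocks (fromBlocks 1 T 0 1) (fromBlocks 0 (persym y) 0 0) 0
      (fromBlocks 1 (-(Xm * persym y)) 0 1)).submatrix (four' a c).symm (four' a c).symm
  have key : spMat (wHat R a c * vTwo X z * iEmb (siegelN y)) =
      M * spMat (wHat R a c * vTwo X (z + sandwich y X)) := by
    rw [spMat_mul _ (iEmb _), spMat_wHat_mul_vTwo, spMat_wHat_mul_vTwo, spMat_iEmb,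
      submatrix_mul_equiv, submatrix_mul_equiv, e2, iMat, spMat_siegelN, toBlocks_fromBlocks₁₁, toBlocks_fromBlocks₁₂,
      toBlocks_fromBlocks₂₁, toBlocks_fromBlocks₂₂]
    congr 1
    change fromBlocks (fromBlocks 0 1 0 0) _ (fromBlocks (-1) (-Xm) 0 0)
      (fromBlocks 0 _ 1 (-X')) * _ = _ * fromBlocks (fromBlocks 0 1 0 0) _
      (fromBlocks (-1) (-Xm) 0 0) (fromBlocks 0 _ 1 (-X'))
    clear_value X' Xm
    simp [fromBlocks_multiply, fromBlocks_add, T, Matrix.mul_assoc]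
  have hM := spMat_mul_inv_eq key
  obtain ⟨y', hy'⟩ := exists_levi_siegelN_of_cols (unipLastGL T) (by
      rw [hM]; ext i j; simp [M, toBlocks₁₁, four', unipLastGL])
    (by rw [hM]; ext i j; simp [M, toBlocks₂₁, four'])
  refine ⟨T, y', ?_⟩
  rw [← hy', inv_mul_cancel_right]

/-! ### The factorization of `w₀ n(Y)` through the smaller group. -/

/-- The coordinates of `Y` in terms of the blocks `Y'`, `X`, `Z` of
`Y = (X, Z; Y', ∗)`. -/
def coordMap (a c : ℕ) :
    Sym2 (Idx a c) ⊕ ((Fin a × Idx a c) ⊕ Sym2 (Fin a)) → Sym2 (Idx a (c + 1)) :=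
  Sum.elim (Sym2.map fun x => splitFirst a c (Sum.inr x))
    (Sum.elim (fun p => s(splitFirst a c (Sum.inl p.1), splitFirst a c (Sum.inr (idxRev p.2))))
      (Sym2.map fun p => splitFirst a c (Sum.inl p)))

/-- An unordered pair from a disjoint union of two sets has both members in one of them, or one
member in each. -/
theorem coordMap_bijective (a c : ℕ) : Function.Bijective (coordMap a c) := by
  have hi := (splitFirst a c).injective
  constructor
  · rintro (u | ⟨p, x⟩ | u) (v | ⟨q, x'⟩ | v) h
    · simp only [coordMap, Sum.elim_inl] at h
      rw [Sym2.map.injective (hi.comp Sum.inr_injective) h]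
    · induction u with | _ u1 u2 =>
      simp [coordMap] at h
    · induction u with | _ u1 u2 =>
      induction v with | _ v1 v2 =>
      simp [coordMap] at h
    · induction v with | _ v1 v2 =>
      simp [coordMap] at h
    · simp [coordMap] at h
      obtain ⟨h1, h2⟩ := h
      have := congrArg idxRev h2
      rw [idxRev_idxRev, idxRev_idxRev] at this
      rw [h1, this]
    · induction v with | _ v1 v2 =>
      simp [coordMap] at h
    · induction u with | _ u1 u2 =>
      induction v with | _ v1 v2 =>
      simp [coordMap] at h
    · induction u with | _ u1 u2 =>
      simp [coordMap] at h
    · simp only [coordMap, Sum.elim_inr] at h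
      rw [Sym2.map.injective (hi.comp Sum.inl_injective) h]
  · intro u
    induction u with | _ u1 u2 =>
    obtain ⟨u1, rfl⟩ := (splitFirst a c).surjective u1
    obtain ⟨u2, rfl⟩ := (splitFirst a c).surjective u2
    rcases u1 with p | x <;> rcases u2 with q | x'
    · exact ⟨Sum.inr (Sum.inr s(p, q)), by simp [coordMap]⟩
    · exact ⟨Sum.inr (Sum.inl (p, idxRev x')), by simp [coordMap, idxRev_idxRev]⟩
    · exact ⟨Sum.inr (Sum.inl (q, idxRev x)), by simp [coordMap, idxRev_idxRev]⟩
    · exact ⟨Sum.inl s(x, x'), by simp [coordMap]⟩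

theorem spMat_w0_mul_siegelN (y : Sym2 (Idx a b) → R) :
    spMat (w0 R a b * siegelN y) = fromBlocks 0 1 (-1) (-persym y) := by
  rw [spMat_mul, spMat_siegelN]
  change fromBlocks 0 1 (-1) 0 * _ = _
  rw [fromBlocks_multiply]; simp

/-- Symmetry around the second diagonal forces the lower right block to be `j ᵗX j`, so `Y'`, `X`,
`Z` carry all the free coordinates. -/
theorem persym_split (y : Sym2 (Idx a (c + 1)) → R) :
    persym y = (fromBlocks
      (Matrix.of fun p x => y (coordMap a c (Sum.inr (Sum.inl (p, x)))))
      (Matrix.of fun p q => y (coordMap a c (Sum.inr (Sum.inr s(p, q.rev)))))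
      (persym fun p => y (coordMap a c (Sum.inl p)))
      (jMat R a c * (Matrix.of fun p x => y (coordMap a c (Sum.inr (Sum.inl (p, x)))))ᵀ *
        jSmall R a)).submatrix (splitFirst a c).symm (splitLast a c).symm := by
  ext i j
  obtain ⟨i, rfl⟩ := (splitFirst a c).surjective i
  obtain ⟨j, rfl⟩ := (splitLast a c).surjective j
  rcases i with i | i <;> rcases j with j | j <;>
    simp only [persym, idxRev_splitLast, coordMap, of_apply, submatrix_apply,
      Equiv.symm_apply_apply, fromBlocks_apply₁₁, fromBlocks_apply₁₂, fromBlocks_apply₂₁,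
      fromBlocks_apply₂₂, Sum.elim_inl, Sum.elim_inr, Sym2.map_mk]
  rw [mul_jSmall_apply, jMat_mul_apply, transpose_apply, of_apply, idxRev_idxRev, Sym2.eq_swap]

/-- The algebraic heart of the proof: it exhibits the integrand of the large operator as an iterated
integrand, with no correction term and no change of coordinates beyond relabelling. -/
theorem w0_siegelN_eq (y : Sym2 (Idx a (c + 1)) → R) : w0 R a (c + 1) * siegelN y =
    wHat R a c * vTwo (fun p => y (coordMap a c (Sum.inr (Sum.inl p))))
      (fun p => y (coordMap a c (Sum.inr (Sum.inr p)))) *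
    iEmb (w0 R a c * siegelN fun p => y (coordMap a c (Sum.inl p))) := by
  apply spMat_injective
  have e1 : spMat (w0 R a (c + 1) * siegelN y) = (fromBlocks (fromBlocks 0 0 0 0)
      (fromBlocks 1 0 0 1) (fromBlocks (-1) 0 0 (-1)) (-((persym y).submatrix
      (splitFirst a c) (splitLast a c)))).submatrix (four' a c).symm (four a c).symm := by
    rw [spMat_w0_mul_siegelN, fromBlocks_one, fromBlocks_zero,
      show fromBlocks (-1) 0 0 (-1) = (-1 : Matrix (Fin a ⊕ Idx a c) (Fin a ⊕ Idx a c) R) by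
        rw [← fromBlocks_one, fromBlocks_neg]; simp]
    ext i j
    rcases i with i | i <;> rcases j with j | j <;> simp [four, four', Matrix.one_apply]
  rw [e1, spMat_mul _ (iEmb _), spMat_wHat_mul_vTwo, spMat_iEmb, submatrix_mul_equiv, iMat,
    spMat_w0_mul_siegelN, toBlocks_fromBlocks₁₁, toBlocks_fromBlocks₁₂, toBlocks_fromBlocks₂₁,
    toBlocks_fromBlocks₂₂, persym_split]
  congr 1
  generalize (Matrix.of fun p x => y (coordMap a c (Sum.inr (Sum.inl (p, x))))) = A
  generalize (Matrix.of fun p (q : Fin a) => y (coordMap a c (Sum.inr (Sum.inr s(p, q.rev))))) = B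
  simp [fromBlocks_multiply, fromBlocks_add, fromBlocks_neg]

end SymplecticAlgebra

/-! ### Column reduction with bounded entries over a normed field. -/

section Pivot

variable {F : Type*} [NormedField F] {κ : Type*} [Fintype κ]

/-- Gaussian elimination with pivoting: the columns of `A` can be modified by an upper triangular
matrix so that all entries are bounded by `1` and some maximal minor is `1`. -/
theorem exists_pivot_fin (n : ℕ) (A : Matrix κ (Fin n) F) (hA : Function.Injective A.mulVec) :
    ∃ (T : Matrix (Fin n) (Fin n) F) (p : Fin n → κ), (∀ i j, j < i → T i j = 0) ∧
      (∀ k j, ‖(A * T) k j‖ ≤ 1) ∧ ((A * T).submatrix p id).det = 1 := by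
  induction n with
  | zero => exact ⟨1, Fin.elim0, fun i => i.elim0, fun _ j => j.elim0, by simp⟩
  | succ n ih =>
    let A' : Matrix κ (Fin n) F := A.submatrix id Fin.castSucc
    have hsnoc : ∀ (x : Fin n → F) (t : F),
        A *ᵥ (Fin.snoc (α := fun _ => F) x t) = A' *ᵥ x + t • fun k => A k (Fin.last n) := by
      intro x t
      ext k
      simp [Matrix.mulVec, dotProduct, Fin.sum_univ_castSucc, A', mul_comm]
    have hA' : Function.Injective A'.mulVec := by
      intro x y hxy
      have := hA (a₁ := Fin.snoc (α := fun _ => F) x 0) (a₂ := Fin.snoc (α := fun _ => F) y 0)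
        (by rw [hsnoc, hsnoc]; simpa using hxy)
      ext i
      simpa using congrFun this i.castSucc
    obtain ⟨T', p', hT', hB', hP⟩ := ih A' hA'
    set B' := A' * T' with hB'def
    set P := B'.submatrix p' id with hPdef
    let v : κ → F := fun k => A k (Fin.last n)
    -- The old pivot minor `P` has determinant `1`, so there are unique coefficients for which `v -
    -- B' d` vanishes on the old pivot rows.
    let d : Fin n → F := P⁻¹ *ᵥ (v ∘ p')
    let v' : κ → F := v - B' *ᵥ d
    have hv'p : ∀ i, v' (p' i) = 0 := by
      intro i
      have : (P *ᵥ d) i = v (p' i) := by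
        simp only [d, mulVec_mulVec]
        rw [Matrix.mul_nonsing_inv _ (by rw [hP]; exact isUnit_one), one_mulVec]; rfl
      simp only [v', Pi.sub_apply]
      rw [← this, sub_eq_zero]; rfl
    have hv'eq : v' = A *ᵥ (Fin.snoc (α := fun _ => F) (-(T' *ᵥ d)) 1) := by
      rw [hsnoc, mulVec_neg, mulVec_mulVec, one_smul, ← hB'def]
      simp only [v', v]; abel
    have hv' : v' ≠ 0 := by
      intro h0
      rw [hv'eq, ← mulVec_zero A] at h0
      simpa using congrFun (hA h0) (Fin.last n)
    obtain ⟨k1, hk1⟩ := Function.ne_iff.1 hv'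
    have : Nonempty κ := ⟨k1⟩
    -- The new pivot row carries the largest entry of the corrected column. Dividing by this entry
    -- bounds the column by `1` and makes the pivot equal to `1`.
    obtain ⟨k0, hk0⟩ := Finite.exists_max fun k => ‖v' k‖
    have hk0' : v' k0 ≠ 0 := by
      rw [← norm_pos_iff]
      exact (norm_pos_iff.2 hk1).trans_le (hk0 k1)
    let T : Matrix (Fin (n + 1)) (Fin (n + 1)) F := Matrix.of fun i j =>
      Fin.snoc (α := fun _ => F) (fun j' => Fin.snoc (α := fun _ => F) (fun i' => T' i' j') 0 i)
        ((v' k0)⁻¹ * Fin.snoc (α := fun _ => F) (-(T' *ᵥ d)) 1 i) j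
    have hcol : ∀ k (j : Fin n), (A * T) k j.castSucc = B' k j := by
      intro k j
      simp [Matrix.mul_apply, T, Fin.sum_univ_castSucc, hB'def, A']
    have hlast : ∀ k, (A * T) k (Fin.last n) = (v' k0)⁻¹ * v' k := by
      intro k
      rw [show v' k = _ from congrFun hv'eq k]
      simp only [Matrix.mul_apply, T, of_apply, Fin.snoc_last, mulVec, dotProduct, Finset.mul_sum]
      exact Finset.sum_congr rfl fun i _ => by ring
    refine ⟨T, Fin.snoc (α := fun _ => κ) p' k0, ?_, ?_, ?_⟩
    · intro i j hij
      induction j using Fin.lastCases with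
      | last => exact absurd hij (not_lt.2 (Fin.le_last i))
      | cast j =>
        induction i using Fin.lastCases with
        | last => simp [T]
        | cast i => simpa [T] using hT' i j (by simpa using hij)
    · intro k j
      induction j using Fin.lastCases with
      | last =>
        rw [hlast, norm_mul, norm_inv, inv_mul_le_iff₀ (norm_pos_iff.2 hk0'), mul_one]
        exact hk0 k
      | cast j => rw [hcol]; exact hB' k j
    -- In the expansion along the new column only the new pivot survives, and its cofactor is the
    -- old minor.
    · rw [Matrix.det_succ_column _ (Fin.last n), Fin.sum_univ_castSucc]
      have h1 : ∀ i : Fin n, (A * T) (p' i) (Fin.last n) = 0 := fun i => by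
        rw [hlast, hv'p, mul_zero]
      have h2 : (A * T) k0 (Fin.last n) = 1 := by rw [hlast, inv_mul_cancel₀ hk0']
      have h3 : (((A * T).submatrix (Fin.snoc (α := fun _ => κ) p' k0) id).submatrix
          (Fin.succAbove (Fin.last n)) (Fin.succAbove (Fin.last n))) = P := by
        ext i j
        simp [hcol, hPdef]
      rw [h3, hP]
      simp [h1, h2, ← two_mul]

theorem exists_pivot {ι : Type*} [Fintype ι] [DecidableEq ι] {n : ℕ} (e : ι ≃ Fin n)
    (A : Matrix κ ι F) (hA : Function.Injective A.mulVec) :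
    ∃ (T : Matrix ι ι F) (p : ι → κ), (∀ i j, e j < e i → T i j = 0) ∧
      (∀ k j, ‖(A * T) k j‖ ≤ 1) ∧ ((A * T).submatrix p id).det = 1 := by
  obtain ⟨T, p, h1, h2, h3⟩ := exists_pivot_fin n (A.submatrix id e.symm) (by
    intro x y hxy
    have : A *ᵥ (x ∘ e) = A *ᵥ (y ∘ e) := by
      simpa [submatrix_mulVec_equiv] using hxy
    exact e.surjective.injective_comp_right (hA this))
  have h4 : A * T.submatrix e e = (A.submatrix id e.symm * T).submatrix id e := by
    ext k i
    simp only [Matrix.mul_apply, submatrix_apply, id]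
    exact Fintype.sum_equiv e _ _ fun x => by simp
  refine ⟨T.submatrix e e, p ∘ e, fun i j hij => h1 _ _ hij, fun k j => ?_, ?_⟩
  · rw [h4]; exact h2 k (e j)
  · rw [h4, ← h3]
    exact Matrix.det_submatrix_equiv_self e ((A.submatrix id e.symm * T).submatrix p id)

end Pivot

/-! ### Topology of the symplectic group: bounded sets of matrices are compact. -/

section SpTopology

variable {F : Type*} [NontriviallyNormedField F] {a b : ℕ}

/-- The symplectic group is homeomorphic to the set of symplectic matrices. -/
def spHomeo (F : Type*) [NontriviallyNormedField F] (a b : ℕ) : Sp a b F ≃ₜ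
    {M : Matrix (Idx a b ⊕ Idx a b) (Idx a b ⊕ Idx a b) F // Mᵀ * JMat F a b * M = JMat F a b} where
  toFun g := ⟨spMat g, spMat_prop g⟩
  invFun M := spMk M.1 M.2
  left_inv g := spMat_injective rfl
  right_inv M := rfl
  continuous_toFun := (Units.continuous_val.comp continuous_subtype_val).subtype_mk _
  continuous_invFun := by
    refine Continuous.subtype_mk (Units.continuous_iff.2 ⟨continuous_subtype_val, ?_⟩) _
    change Continuous fun M : {M : Matrix (Idx a b ⊕ Idx a b) (Idx a b ⊕ Idx a b) F //
      Mᵀ * JMat F a b * M = JMat F a b} => -(JMat F a b * M.1ᵀ * JMat F a b)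
    fun_prop

/-- The inverse of a symplectic matrix is a polynomial in its entries, so the topology of the group
of units restricts to that of matrices. This is what allows continuity and compactness to be checked
entrywise. -/
theorem isClosedEmbedding_spMat :
    Topology.IsClosedEmbedding (spMat : Sp a b F → Matrix (Idx a b ⊕ Idx a b) (Idx a b ⊕ Idx a b) F) := by
  have h : IsClosed {M : Matrix (Idx a b ⊕ Idx a b) (Idx a b ⊕ Idx a b) F |
      Mᵀ * JMat F a b * M = JMat F a b} :=
    isClosed_eq (by fun_prop) continuous_const
  exact h.isClosedEmbedding_subtypeVal.comp (spHomeo F a b).isClosedEmbedding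

theorem continuous_spMat : Continuous (spMat : Sp a b F → _) :=
  isClosedEmbedding_spMat.continuous

theorem continuous_sp_iff {X : Type*} [TopologicalSpace X] {f : X → Sp a b F} :
    Continuous f ↔ Continuous fun x => spMat (f x) :=
  isClosedEmbedding_spMat.isInducing.continuous_iff

instance : FirstCountableTopology (Sp a b F) :=
  haveI : FirstCountableTopology (Matrix (Idx a b ⊕ Idx a b) (Idx a b ⊕ Idx a b) F) :=
    inferInstanceAs (FirstCountableTopology (Idx a b ⊕ Idx a b → Idx a b ⊕ Idx a b → F))
  isClosedEmbedding_spMat.isInducing.firstCountableTopology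

theorem isCompact_cube [ProperSpace F] {m n : Type*} (C : ℝ) :
    IsCompact {M : Matrix m n F | ∀ i j, ‖M i j‖ ≤ C} := by
  have : {M : Matrix m n F | ∀ i j, ‖M i j‖ ≤ C} =
      Set.pi Set.univ fun _ : m => Set.pi Set.univ fun _ : n => Metric.closedBall (0 : F) C := by
    ext M
    exact ⟨fun h i _ j _ => by simpa using h i j,
      fun h i j => by simpa using h i trivial j trivial⟩
  rw [this]
  exact isCompact_univ_pi fun _ => isCompact_univ_pi fun _ => isCompact_closedBall 0 C

theorem isCompact_sp_bounded [ProperSpace F] (C : ℝ) :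
    IsCompact {g : Sp a b F | ∀ i j, ‖spMat g i j‖ ≤ C} :=
  isClosedEmbedding_spMat.isCompact_preimage (isCompact_cube C)

end SpTopology

/-! ### An Iwasawa-type decomposition with a bounded set in place of a maximal compact subgroup. -/

section Iwasawa

variable {a b : ℕ}

theorem JMat_transpose {R : Type*} [CommRing R] : (JMat R a b)ᵀ = -JMat R a b := by
  simp [JMat, fromBlocks_transpose, jMat_transpose, fromBlocks_neg]

/-- An isotropic frame `B` with left inverse `R` is completed to a symplectic matrix `(B, U)`. -/
def completion {F : Type*} [Field F] (B : Matrix (Idx a b ⊕ Idx a b) (Idx a b) F)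
    (R : Matrix (Idx a b) (Idx a b ⊕ Idx a b) F) :
    Matrix (Idx a b ⊕ Idx a b) (Idx a b ⊕ Idx a b) F :=
  let U := -(JMat F a b * Rᵀ * jMat F a b)
  fromCols B (U + (2⁻¹ : F) • (B * jMat F a b * (Uᵀ * JMat F a b * U)))

/-- Since `R B = 1`, the matrix `U = -J ᵗR j` pairs with `B` to `j`, but its columns need not be
isotropic. Adding half of `B j (ᵗU J U)` cancels the self-pairing of `U`, and leaves the pairing
with `B` unchanged because `B` is isotropic. -/
theorem completion_symplectic {F : Type*} [Field F] [CharZero F]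
    {B : Matrix (Idx a b ⊕ Idx a b) (Idx a b) F} {R : Matrix (Idx a b) (Idx a b ⊕ Idx a b) F}
    (h1 : R * B = 1) (h2 : Bᵀ * JMat F a b * B = 0) :
    (completion B R)ᵀ * JMat F a b * completion B R = JMat F a b := by
  set U := -(JMat F a b * Rᵀ * jMat F a b) with hU
  set A := Uᵀ * JMat F a b * U with hA
  set V := U + (2⁻¹ : F) • (B * jMat F a b * A) with hV
  have hc : completion B R = fromCols B V := rfl
  have hBU : Bᵀ * JMat F a b * U = jMat F a b := by
    rw [hU, Matrix.mul_neg, ← Matrix.mul_assoc, ← Matrix.mul_assoc, Matrix.mul_assoc Bᵀ,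
      JMat_mul_JMat, Matrix.mul_neg, Matrix.mul_one, Matrix.neg_mul, Matrix.neg_mul, neg_neg,
      ← transpose_mul, h1, transpose_one, Matrix.one_mul]
  have hskew : ∀ (M N : Matrix (Idx a b ⊕ Idx a b) (Idx a b) F),
      Nᵀ * JMat F a b * M = -(Mᵀ * JMat F a b * N)ᵀ := by
    intro M N
    simp [transpose_mul, JMat_transpose, Matrix.mul_assoc]
  have hUB : Uᵀ * JMat F a b * B = -jMat F a b := by rw [hskew, hBU, jMat_transpose]
  have hAt : Aᵀ = -A := by
    rw [hA]; conv_rhs => rw [hskew]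
    rw [neg_neg]
  have hassoc : ∀ M : Matrix (Idx a b ⊕ Idx a b) (Idx a b) F,
      Mᵀ * JMat F a b * (B * jMat F a b * A) = Mᵀ * JMat F a b * B * (jMat F a b * A) := by
    intro M; rw [Matrix.mul_assoc B, ← Matrix.mul_assoc _ B]
  have hBV : Bᵀ * JMat F a b * V = jMat F a b := by
    rw [hV, Matrix.mul_add, hBU, Matrix.mul_smul, hassoc, h2]
    simp
  have hVB : Vᵀ * JMat F a b * B = -jMat F a b := by rw [hskew, hBV, jMat_transpose]
  have hVV : Vᵀ * JMat F a b * V = 0 := by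
    have e1 : Vᵀ * JMat F a b * U = (2⁻¹ : F) • A := by
      rw [hskew]
      have : Uᵀ * JMat F a b * V = (2⁻¹ : F) • A := by
        rw [hV, Matrix.mul_add, Matrix.mul_smul, hassoc, hUB,
          Matrix.neg_mul, ← Matrix.mul_assoc, jMat_mul_jMat, Matrix.one_mul, ← hA]
        have : A = (2⁻¹ : F) • A + (2⁻¹ : F) • A := by
          rw [← add_smul, ← two_mul, mul_inv_cancel₀ two_ne_zero, one_smul]
        conv_lhs => lhs; rw [this]
        simp
      rw [this, transpose_smul, hAt]; simp
    have e2 : Vᵀ * JMat F a b * (B * jMat F a b * A) = -A := by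
      rw [hassoc, hVB, Matrix.neg_mul, ← Matrix.mul_assoc, jMat_mul_jMat, Matrix.one_mul]
    conv_lhs => rw [hV]
    rw [← hV, Matrix.mul_add, Matrix.mul_smul, e1, e2]; simp
  rw [hc, transpose_fromCols, fromRows_mul, fromRows_mul_fromCols, h2, hBV, hVB, hVV]
  rfl

/-- The order of `Idx a b` by blocks. -/
def idxEquivFin (a b : ℕ) : Idx a b ≃ Fin (b * a) :=
  (Equiv.prodComm _ _).trans finProdFinEquiv

theorem idxEquivFin_lt {x y : Idx a b} (h : x.2 < y.2) : idxEquivFin a b x < idxEquivFin a b y := by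
  rw [Fin.lt_def]
  simp only [idxEquivFin, Equiv.trans_apply, Equiv.prodComm_apply, finProdFinEquiv_apply_val,
    Prod.fst_swap, Prod.snd_swap]
  calc (x.1 : ℕ) + a * x.2 < a + a * x.2 := by have := x.1.2; omega
    _ = a * (x.2 + 1) := by ring
    _ ≤ a * y.2 := Nat.mul_le_mul_left _ (Fin.lt_def.1 h)
    _ ≤ _ := Nat.le_add_left _ _

/-- Iwasawa decomposition: the symplectic group is the product of the standard parabolic subgroup
and a bounded set. -/
theorem exists_iwasawa (F : Type*) [NontriviallyNormedField F] [ProperSpace F] [CharZero F]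
    (a b : ℕ) : ∃ C : ℝ, ∀ g : Sp a b F, ∃ (T : GL (Idx a b) F) (y : Sym2 (Idx a b) → F)
      (q : Sp a b F), (∀ x x' : Idx a b, x'.2 < x.2 → (T : Matrix (Idx a b) (Idx a b) F) x x' = 0) ∧
        (∀ i j, ‖spMat q i j‖ ≤ C) ∧ g = leviSp T * siegelN y * q⁻¹ := by
  let sel (p : Idx a b → Idx a b ⊕ Idx a b) : Matrix (Idx a b) (Idx a b ⊕ Idx a b) F :=
    Matrix.of fun i k => if p i = k then 1 else 0
  have hsel : ∀ p (B : Matrix (Idx a b ⊕ Idx a b) (Idx a b) F), sel p * B = B.submatrix p id := by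
    intro p B; ext i j; simp [sel, Matrix.mul_apply]
  -- When the chosen minor of `B` is `1`, its adjugate is its inverse and gives a left inverse of
  -- `B`. Using the adjugate keeps `Q` polynomial in `B`, hence bounded on the whole unit cube,
  -- although it is symplectic only for suitable `B`.
  let Q (p : Idx a b → Idx a b ⊕ Idx a b) (B : Matrix (Idx a b ⊕ Idx a b) (Idx a b) F) :=
    completion B ((B.submatrix p id).adjugate * sel p)
  have hQ : ∀ p, Continuous (Q p) := by
    intro p
    have h1 : Continuous fun B : Matrix (Idx a b ⊕ Idx a b) (Idx a b) F =>
        (B.submatrix p id).adjugate * sel p := by fun_prop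
    have h2 : Continuous fun B : Matrix (Idx a b ⊕ Idx a b) (Idx a b) F =>
        -(JMat F a b * ((B.submatrix p id).adjugate * sel p)ᵀ * jMat F a b) := by fun_prop
    have h3 : Continuous fun B : Matrix (Idx a b ⊕ Idx a b) (Idx a b) F =>
        -(JMat F a b * ((B.submatrix p id).adjugate * sel p)ᵀ * jMat F a b) +
        (2⁻¹ : F) • (B * jMat F a b *
          ((-(JMat F a b * ((B.submatrix p id).adjugate * sel p)ᵀ * jMat F a b))ᵀ * JMat F a b *
          -(JMat F a b * ((B.submatrix p id).adjugate * sel p)ᵀ * jMat F a b))) :=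
      by fun_prop
    refine continuous_matrix fun i j => ?_
    rcases j with j | j
    · exact continuous_id.matrix_elem i j
    · exact h3.matrix_elem i j
  have hbd : ∀ p i j, ∃ C, ∀ B ∈ {B : Matrix (Idx a b ⊕ Idx a b) (Idx a b) F | ∀ k l, ‖B k l‖ ≤ 1},
      ‖Q p B i j‖ ≤ C := fun p i j =>
    (isCompact_cube 1).exists_bound_of_continuousOn ((hQ p).matrix_elem i j).continuousOn
  choose C hC using hbd
  obtain ⟨C0, hC0⟩ := (Set.finite_range fun x : _ × _ × _ => C x.1 x.2.1 x.2.2).bddAbove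
  refine ⟨C0, fun g => ?_⟩
  -- These columns span a Lagrangian subspace, and left multiplication of `g` by the Siegel
  -- parabolic only changes their basis. Column reduction of `A` thus finds the Levi part.
  let A : Matrix (Idx a b ⊕ Idx a b) (Idx a b) F := (spMat g⁻¹).submatrix id Sum.inl
  have hAinj : Function.Injective A.mulVec := by
    have : (spMat g).submatrix Sum.inl id * A = 1 := by
      have h := congrArg (fun M => M.submatrix Sum.inl Sum.inl) (spMat_mul_inv g)
      ext i j
      exact (congrFun (congrFun h i) j).trans (by simp [Matrix.one_apply])
    intro x y hxy
    have h := congrArg (fun v => (spMat g).submatrix Sum.inl id *ᵥ v) hxy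
    simpa [mulVec_mulVec, this] using h
  obtain ⟨T, p, hT, hB, hP⟩ := exists_pivot (idxEquivFin a b) A hAinj
  set B := A * T with hBdef
  have hTdet : IsUnit T.det := by
    have : B.submatrix p id = A.submatrix p id * T := rfl
    rw [this, det_mul] at hP
    exact IsUnit.of_mul_eq_one_right _ hP
  have hAJ : Aᵀ * JMat F a b * A = 0 := by
    have h := congrArg (fun M => M.submatrix Sum.inl Sum.inl) (spMat_prop g⁻¹)
    ext i j
    have h' := congrFun (congrFun h i) j
    exact h'.trans (by simp [JMat])
  have hBJ : Bᵀ * JMat F a b * B = 0 := by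
    calc _ = Tᵀ * (Aᵀ * JMat F a b * A) * T := by
          rw [hBdef, transpose_mul]; simp only [Matrix.mul_assoc]
      _ = 0 := by rw [hAJ]; simp
  have hRB : (B.submatrix p id).adjugate * sel p * B = 1 := by
    rw [Matrix.mul_assoc, hsel, adjugate_mul, hP, one_smul]
  let q : Sp a b F := spMk (Q p B) (completion_symplectic hRB hBJ)
  let Tu : GL (Idx a b) F := Matrix.nonsingInvUnit T hTdet
  have hq1 : (spMat q).submatrix id Sum.inl = B := by
    ext i j; rfl
  -- `q` and `g⁻¹ m(T)` share their first half of columns `B`, so they differ by an element of the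
  -- Siegel unipotent radical.
  have hcols : (spMat (q⁻¹ * (g⁻¹ * leviSp Tu))).submatrix id Sum.inl =
      (1 : Matrix (Idx a b ⊕ Idx a b) (Idx a b ⊕ Idx a b) F).submatrix id Sum.inl := by
    have e1 : (spMat (g⁻¹ * leviSp Tu)).submatrix id Sum.inl = B := by
      rw [spMat_mul, spMat_leviSp]
      ext i j
      simp [Matrix.mul_apply, hBdef, A, Tu]
      rfl
    calc _ = spMat q⁻¹ * (spMat (g⁻¹ * leviSp Tu)).submatrix id Sum.inl := rfl
      _ = (spMat q⁻¹ * spMat q).submatrix id Sum.inl := by rw [e1, ← hq1]; rfl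
      _ = _ := by rw [spMat_inv_mul]
  obtain ⟨y, hy⟩ := exists_siegelN_of_cols (g := q⁻¹ * (g⁻¹ * leviSp Tu))
    (by ext i j; exact (congrFun (congrFun hcols (Sum.inl i)) j).trans (by simp [Matrix.one_apply]))
    (by ext i j; exact (congrFun (congrFun hcols (Sum.inr i)) j).trans (by simp))
  refine ⟨Tu, -y, q, fun x x' h => hT _ _ (idxEquivFin_lt h), fun i j => ?_, ?_⟩
  · exact (hC p i j B hB).trans (hC0 ⟨(p, i, j), rfl⟩)
  · rw [siegelN_neg, ← hy]
    group

end Iwasawa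

/-! ### Frame volumes and their behaviour under left and right multiplication. -/

section FrameVolume

open scoped NNReal ENNReal

variable {F : Type*} [NontriviallyNormedField F] {a b c : ℕ}

/-- The vectors mapped by `A` into the unit cube. -/
def unitSet {κ ι : Type*} [Fintype ι] (A : Matrix κ ι F) : Set (ι → F) :=
  {x | ∀ k, ‖(A *ᵥ x) k‖ ≤ 1}

/-- The columns of `g⁻¹` in the blocks `0, …, i`. -/
def frame (i : Fin b) (g : Sp a b F) :
    Matrix (Idx a b ⊕ Idx a b) (Fin a × {l : Fin b // l ≤ i}) F :=
  (spMat g⁻¹).submatrix id fun x => Sum.inl (x.1, x.2.1)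

theorem frame_mul (i : Fin b) (g k : Sp a b F) : frame i (g * k) = spMat k⁻¹ * frame i g := by
  rw [frame, _root_.mul_inv_rev, spMat_mul]; rfl

theorem frame_siegelN_mul (i : Fin b) (y : Sym2 (Idx a b) → F) (g : Sp a b F) :
    frame i (siegelN y * g) = frame i g := by
  rw [frame, _root_.mul_inv_rev, spMat_mul, ← siegelN_neg, spMat_siegelN]
  ext k x
  simp [frame, Matrix.mul_apply, Matrix.one_apply]

/-- The block upper triangular condition with respect to the second component of the indices. -/
def IsUpper {L : Type*} [LinearOrder L] (T : Matrix (Fin a × L) (Fin a × L) F) : Prop :=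
  ∀ x x', x'.2 < x.2 → T x x' = 0

/-- The restriction of a matrix to the blocks `0, …, i`. -/
def restrictBlocks (i : Fin b) (T : Matrix (Idx a b) (Idx a b) F) :
    Matrix (Fin a × {l : Fin b // l ≤ i}) (Fin a × {l : Fin b // l ≤ i}) F :=
  T.submatrix (fun x => (x.1, x.2.1)) (fun x => (x.1, x.2.1))

/-- A block upper triangular `T` preserves the span of the first blocks, so on these columns it acts
by its own upper left corner. -/
theorem frame_leviSp_mul (i : Fin b) (T : GL (Idx a b) F)
    (hT : IsUpper (T : Matrix (Idx a b) (Idx a b) F)) (g : Sp a b F) :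
    frame i (leviSp T * g) * restrictBlocks i (T : Matrix (Idx a b) (Idx a b) F) = frame i g := by
  have h : spMat g⁻¹ = spMat (leviSp T * g)⁻¹ * spMat (leviSp T) := by
    rw [← spMat_mul]; congr 1; group
  ext k x
  rw [frame, frame, h, spMat_leviSp]
  simp only [submatrix_apply, Matrix.mul_apply, id, Fintype.sum_sum_type, fromBlocks_apply₁₁,
    fromBlocks_apply₂₁, Matrix.zero_apply, mul_zero, Finset.sum_const_zero, add_zero,
    restrictBlocks]
  refine Finset.sum_of_injOn (fun x => (x.1, x.2.1)) ?_ (by simp) ?_ (fun _ _ => rfl)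
  · rintro ⟨p, l⟩ - ⟨p', l'⟩ - h
    simp only [Prod.mk.injEq] at h
    exact Prod.ext h.1 (Subtype.ext h.2)
  · rintro ⟨p, l⟩ - hl
    rw [hT _ _ ?_, mul_zero]
    by_contra hle
    exact hl ⟨(p, ⟨l, (not_lt.1 hle).trans x.2.2⟩), by simp, rfl⟩

theorem unitSet_mul {κ ι : Type*} [Fintype ι] [Fintype κ] (A : Matrix κ ι F) (T : Matrix ι ι F) :
    unitSet (A * T) = (T *ᵥ ·) ⁻¹' unitSet A := by
  ext x; simp [unitSet, mulVec_mulVec]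

theorem det_eq_one_of_unip {L : Type*} [Fintype L] [LinearOrder L]
    (M : Matrix (Fin a × L) (Fin a × L) F) (h : ∀ x y, y.2 ≤ x.2 → M x y = (1 : Matrix _ _ F) x y) :
    M.det = 1 := by
  have hM : M.BlockTriangular Prod.snd := by
    intro x y hxy
    rw [h x y hxy.le, Matrix.one_apply_ne]
    rintro rfl; exact lt_irrefl _ hxy
  rw [hM.det_fintype]
  refine Finset.prod_eq_one fun k _ => ?_
  rw [show M.toSquareBlock Prod.snd k = 1 from ?_, det_one]
  ext x y
  rw [toSquareBlock_def, of_apply, h _ _ (by rw [x.2, y.2]), Matrix.one_apply, Matrix.one_apply]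
  simp [Subtype.ext_iff]

theorem IsUnipGL.det {u : GL (Idx a b) F} (hu : IsUnipGL u) :
    (u : Matrix (Idx a b) (Idx a b) F).det = 1 := det_eq_one_of_unip _ hu

theorem IsUnipGL.isUpper {u : GL (Idx a b) F} (hu : IsUnipGL u) :
    IsUpper (u : Matrix (Idx a b) (Idx a b) F) := by
  intro x y hxy
  rw [hu x y hxy.le, Matrix.one_apply_ne]
  rintro rfl; exact lt_irrefl _ hxy

theorem IsUnipGL.det_restrictBlocks {u : GL (Idx a b) F} (hu : IsUnipGL u) (i : Fin b) :
    (restrictBlocks i (u : Matrix (Idx a b) (Idx a b) F)).det = 1 := by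
  refine det_eq_one_of_unip _ fun x y h => ?_
  rw [restrictBlocks, submatrix_apply, hu _ _ h, Matrix.one_apply, Matrix.one_apply]
  simp [Prod.ext_iff, Subtype.ext_iff]

theorem coe_blockGL (t : Fin b → GL (Fin a) F) :
    (blockGL F a b t : Matrix (Idx a b) (Idx a b) F) =
      blockDiagonal fun l => (t l : Matrix (Fin a) (Fin a) F) := rfl

theorem isUpper_blockGL (t : Fin b → GL (Fin a) F) :
    IsUpper (blockGL F a b t : Matrix (Idx a b) (Idx a b) F) := by
  intro x y h
  rw [coe_blockGL, blockDiagonal_apply, if_neg h.ne']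

theorem det_restrictBlocks_blockGL (i : Fin b) (t : Fin b → GL (Fin a) F) :
    (restrictBlocks i (blockGL F a b t : Matrix (Idx a b) (Idx a b) F)).det =
      ∏ l : {l : Fin b // l ≤ i}, (t l.1 : Matrix (Fin a) (Fin a) F).det := by
  have : restrictBlocks i (blockGL F a b t : Matrix (Idx a b) (Idx a b) F) =
      blockDiagonal fun l : {l : Fin b // l ≤ i} => (t l.1 : Matrix (Fin a) (Fin a) F) := by
    ext x y
    rw [restrictBlocks, submatrix_apply, coe_blockGL, blockDiagonal_apply, blockDiagonal_apply]
    simp [Subtype.ext_iff]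
  rw [this, det_blockDiagonal]

theorem det_blockGL (t : Fin b → GL (Fin a) F) :
    (blockGL F a b t : Matrix (Idx a b) (Idx a b) F).det =
      ∏ l, (t l : Matrix (Fin a) (Fin a) F).det := by
  rw [coe_blockGL, det_blockDiagonal]

/-- Levi decomposition of the block upper triangular matrices. -/
theorem exists_unip_mul_blockGL (T : GL (Idx a b) F)
    (hT : IsUpper (T : Matrix (Idx a b) (Idx a b) F)) :
    ∃ (u : GL (Idx a b) F) (t : Fin b → GL (Fin a) F), IsUnipGL u ∧ T = u * blockGL F a b t := by
  let D : Fin b → Matrix (Fin a) (Fin a) F := fun l =>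
    (T : Matrix (Idx a b) (Idx a b) F).submatrix (fun p => (p, l)) (fun p => (p, l))
  have hM : (T : Matrix (Idx a b) (Idx a b) F).BlockTriangular Prod.snd := fun x y h => hT x y h
  have hdet : (T : Matrix (Idx a b) (Idx a b) F).det = ∏ l, (D l).det := by
    rw [hM.det_fintype]
    refine Finset.prod_congr rfl fun l _ => ?_
    let e : Fin a ≃ {x : Idx a b // x.2 = l} :=
      { toFun := fun p => ⟨(p, l), rfl⟩
        invFun := fun x => x.1.1
        left_inv := fun p => rfl
        right_inv := by rintro ⟨⟨p, l'⟩, rfl⟩; rfl }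
    rw [← Matrix.det_submatrix_equiv_self e]
    rfl
  -- The determinant of a block triangular matrix is the product of those of its diagonal blocks.
  have hD : ∀ l, IsUnit (D l).det := by
    intro l
    have h1 : IsUnit (T : Matrix (Idx a b) (Idx a b) F).det :=
      (Matrix.isUnit_iff_isUnit_det _).1 T.isUnit
    rw [hdet, isUnit_iff_ne_zero, Finset.prod_ne_zero_iff] at h1
    exact isUnit_iff_ne_zero.2 (h1 l (Finset.mem_univ l))
  let t : Fin b → GL (Fin a) F := fun l => Matrix.nonsingInvUnit (D l) (hD l)
  refine ⟨T * blockGL F a b t⁻¹, t, ?_, by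
    rw [mul_assoc, ← map_mul, inv_mul_cancel, map_one, mul_one]⟩
  rintro ⟨p, l⟩ ⟨q, m⟩ hlm
  have hval : ((T * blockGL F a b t⁻¹ : GL (Idx a b) F) : Matrix (Idx a b) (Idx a b) F)
      (p, l) (q, m) = ∑ r, (T : Matrix (Idx a b) (Idx a b) F) (p, l) (r, m) *
        ((t m)⁻¹ : GL (Fin a) F).1 r q := by
    rw [Units.val_mul, coe_blockGL, Matrix.mul_apply, Fintype.sum_prod_type]
    refine Finset.sum_congr rfl fun r _ => ?_
    simp [blockDiagonal_apply]
  rw [hval]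
  rcases hlm.lt_or_eq with h | h
  · rw [Matrix.one_apply_ne (by rintro ⟨⟩; exact lt_irrefl _ h)]
    exact Finset.sum_eq_zero fun r _ => by rw [hT (p, l) (r, m) h, zero_mul]
  · simp only at h
    subst h
    have h1 : (t m : Matrix (Fin a) (Fin a) F) * ((t m)⁻¹ : GL (Fin a) F).1 = 1 :=
      Units.mul_inv (t m)
    have h2 := congrFun (congrFun h1 p) q
    rw [Matrix.mul_apply] at h2
    refine h2.trans ?_
    simp [Matrix.one_apply]

theorem exists_entries_le (g : Sp a b F) : ∃ R : ℝ, ∀ x y, ‖spMat g x y‖ ≤ R := by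
  obtain ⟨R, hR⟩ := (Set.finite_range fun p : _ × _ => ‖spMat g p.1 p.2‖).bddAbove
  exact ⟨R, fun x y => hR ⟨(x, y), rfl⟩⟩

variable [ProperSpace F] [MeasurableSpace F] [BorelSpace F] (μ : Measure F) [μ.IsAddHaarMeasure]

/-- The volume of the set of vectors mapped to the unit cube by the columns of `g⁻¹` in the
blocks `0, …, i`. -/
noncomputable def frameVol (i : Fin b) (g : Sp a b F) : ℝ≥0∞ :=
  (Measure.pi fun _ => μ) (unitSet (frame i g))

theorem frameVol_siegelN_mul (i : Fin b) (y : Sym2 (Idx a b) → F) (g : Sp a b F) :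
    frameVol μ i (siegelN y * g) = frameVol μ i g := by
  rw [frameVol, frame_siegelN_mul, frameVol]

theorem frameVol_leviSp_mul (i : Fin b) (T : GL (Idx a b) F)
    (hT : IsUpper (T : Matrix (Idx a b) (Idx a b) F))
    (hT' : (restrictBlocks i (T : Matrix (Idx a b) (Idx a b) F)).det ≠ 0) (g : Sp a b F) :
    frameVol μ i (leviSp T * g) =
      modF (restrictBlocks i (T : Matrix (Idx a b) (Idx a b) F)).det * frameVol μ i g := by
  rw [frameVol, frameVol, ← frame_leviSp_mul i T hT g, unitSet_mul, measure_preimage_mulVec μ hT',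
    ← mul_assoc, ← ENNReal.coe_mul, mul_inv_cancel₀ (modF_ne_zero hT'), ENNReal.coe_one, one_mul]

theorem frameVol_unip_mul (i : Fin b) {u : GL (Idx a b) F} (hu : IsUnipGL u) (g : Sp a b F) :
    frameVol μ i (leviSp u * g) = frameVol μ i g := by
  rw [frameVol_leviSp_mul μ i u hu.isUpper (by rw [hu.det_restrictBlocks]; exact one_ne_zero),
    hu.det_restrictBlocks, modF_one, ENNReal.coe_one, one_mul]

theorem frameVol_blockGL_mul (i : Fin b) (t : Fin b → GL (Fin a) F) (g : Sp a b F) :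
    frameVol μ i (leviSp (blockGL F a b t) * g) =
      ((∏ l : {l : Fin b // l ≤ i}, modF (t l.1 : Matrix (Fin a) (Fin a) F).det : ℝ≥0) : ℝ≥0∞) *
        frameVol μ i g := by
  rw [frameVol_leviSp_mul μ i _ (isUpper_blockGL t), det_restrictBlocks_blockGL, modF_prod]
  rw [det_restrictBlocks_blockGL, Finset.prod_ne_zero_iff]
  exact fun l _ => ((Matrix.isUnit_iff_isUnit_det _).1 (t l.1).isUnit).ne_zero

/-- The frame of `g` is `k` times that of `g k`, and `k` maps the unit cube into a fixed multiple of
it. Shrinking the coefficient vectors by a scalar `z` compensates, at the cost of a constant factor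
of volume. -/
theorem exists_frameVol_mul_le (i : Fin b) (R : ℝ) : ∃ C : ℝ≥0, ∀ k : Sp a b F,
    (∀ x y, ‖spMat k x y‖ ≤ R) → ∀ g, frameVol μ i (g * k) ≤ C * frameVol μ i g := by
  -- The maximum with `0` ensures `z ≠ 0` even when the stated bound `R` is negative.
  obtain ⟨z, hz⟩ := NormedField.exists_lt_norm F
    (max 0 (Fintype.card (Idx a b ⊕ Idx a b) * R))
  have hz0 : z ≠ 0 := norm_pos_iff.1 ((le_max_left _ _).trans_lt hz)
  let D : Matrix (Fin a × {l : Fin b // l ≤ i}) (Fin a × {l : Fin b // l ≤ i}) F :=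
    diagonal fun _ => z⁻¹
  have hD : D.det ≠ 0 := by
    rw [det_diagonal, Finset.prod_ne_zero_iff]
    exact fun _ _ => inv_ne_zero hz0
  refine ⟨(modF D.det)⁻¹, fun k hk g => ?_⟩
  rw [frameVol, frameVol, ← measure_preimage_mulVec μ hD]
  refine measure_mono fun x hx => ?_
  have hDx : D *ᵥ x = z⁻¹ • x := by
    ext j; simp [D, mulVec_diagonal]
  have hfr : frame i g = spMat k * frame i (g * k) := by
    rw [frame_mul, ← Matrix.mul_assoc, spMat_mul_inv, Matrix.one_mul]
  change ∀ m, ‖(frame i g *ᵥ (D *ᵥ x)) m‖ ≤ 1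
  intro m
  rw [hDx, mulVec_smul, Pi.smul_apply, norm_smul, norm_inv, inv_mul_le_iff₀ (norm_pos_iff.2 hz0),
    mul_one, hfr, ← mulVec_mulVec]
  refine le_trans ?_ ((le_max_right _ _).trans hz.le)
  calc ‖(spMat k *ᵥ (frame i (g * k) *ᵥ x)) m‖
      ≤ ∑ j, ‖spMat k m j * (frame i (g * k) *ᵥ x) j‖ := norm_sum_le _ _
    _ ≤ ∑ _j : Idx a b ⊕ Idx a b, R := by
      refine Finset.sum_le_sum fun j _ => ?_
      rw [norm_mul]
      calc _ ≤ R * 1 := mul_le_mul (hk m j) (hx j) (norm_nonneg _)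
            ((norm_nonneg _).trans (hk m j))
        _ = R := mul_one R
    _ = _ := by rw [Finset.sum_const, Finset.card_univ, nsmul_eq_mul]

theorem frameVol_one (i : Fin b) : frameVol μ i (1 : Sp a b F) =
    ∏ _j : Fin a × {l : Fin b // l ≤ i}, μ (Metric.closedBall (0 : F) 1) := by
  rw [frameVol, ← Measure.pi_pi]
  congr 1
  ext x
  have h : ∀ k, (frame i (1 : Sp a b F) *ᵥ x) k = Sum.elim
      (fun y : Idx a b => if h : y.2 ≤ i then x (y.1, ⟨y.2, h⟩) else 0) 0 k := by
    rintro (⟨p, l⟩ | y)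
    · by_cases hl : l ≤ i
      · simp only [Sum.elim_inl, hl, dite_true, mulVec, dotProduct]
        rw [Finset.sum_eq_single (p, ⟨l, hl⟩)]
        · simp [frame, spMat_one, Matrix.one_apply]
        · rintro ⟨q, m⟩ - hne
          have : ¬ (p = q ∧ l = m) := by
            rintro ⟨rfl, rfl⟩; exact hne rfl
          simp [frame, spMat_one, this]
        · simp
      · simp only [Sum.elim_inl, hl, dite_false, mulVec, dotProduct]
        refine Finset.sum_eq_zero ?_
        rintro ⟨q, m⟩ -
        have : l ≠ m := by rintro rfl; exact hl m.2
        simp [frame, spMat_one, this]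
    · simp [frame, spMat_one, mulVec, dotProduct]
  simp only [unitSet, Set.mem_ofPred_eq, h, Set.mem_univ_pi, Metric.mem_closedBall, dist_zero_right]
  constructor
  · rintro H ⟨p, l, hl⟩
    simpa [hl] using H (Sum.inl (p, l))
  · rintro H (⟨p, l⟩ | y)
    · by_cases hl : l ≤ i
      · simpa [hl] using H (p, ⟨l, hl⟩)
      · simp [hl]
    · simp

theorem frameVol_one_ne_top (i : Fin b) : frameVol μ i (1 : Sp a b F) ≠ ∞ := by
  rw [frameVol_one]
  exact ENNReal.prod_ne_top fun _ _ => (isCompact_closedBall (0:F) 1).measure_lt_top.ne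

theorem frameVol_one_ne_zero (i : Fin b) : frameVol μ i (1 : Sp a b F) ≠ 0 := by
  rw [frameVol_one, Finset.prod_ne_zero_iff]
  exact fun _ _ => (Metric.measure_closedBall_pos μ _ one_pos).ne'

theorem frameVol_ne_top (i : Fin b) (g : Sp a b F) : frameVol μ i g ≠ ∞ := by
  obtain ⟨R, hR⟩ := exists_entries_le g
  obtain ⟨C, hC⟩ := exists_frameVol_mul_le μ (a := a) i R
  have := hC g hR 1
  rw [one_mul] at this
  exact ne_top_of_le_ne_top (ENNReal.mul_ne_top ENNReal.coe_ne_top (frameVol_one_ne_top μ i)) this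

/-- The real number underlying `frameVol`. -/
noncomputable def frameVolR (i : Fin b) (g : Sp a b F) : ℝ := (frameVol μ i g).toReal

theorem frameVolR_nonneg (i : Fin b) (g : Sp a b F) : 0 ≤ frameVolR μ i g := ENNReal.toReal_nonneg

theorem frameVolR_one_pos (i : Fin b) : 0 < frameVolR μ i (1 : Sp a b F) :=
  ENNReal.toReal_pos (frameVol_one_ne_zero μ i) (frameVol_one_ne_top μ i)

theorem exists_frameVolR_mul_le (i : Fin b) (R : ℝ) : ∃ C : ℝ, 0 ≤ C ∧ ∀ k : Sp a b F,
    (∀ x y, ‖spMat k x y‖ ≤ R) → ∀ g, frameVolR μ i (g * k) ≤ C * frameVolR μ i g := by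
  obtain ⟨C, hC⟩ := exists_frameVol_mul_le μ (a := a) i R
  refine ⟨C, C.2, fun k hk g => ?_⟩
  have h := ENNReal.toReal_mono
    (ENNReal.mul_ne_top ENNReal.coe_ne_top (frameVol_ne_top μ i g)) (hC k hk g)
  rwa [ENNReal.toReal_mul, ENNReal.coe_toReal] at h

/-- On a bounded set of elements `q`, the frame volumes of `q⁻¹` are bounded below. -/
theorem exists_le_frameVolR_inv (i : Fin b) (R : ℝ) : ∃ δ : ℝ, 0 < δ ∧ ∀ q : Sp a b F,
    (∀ x y, ‖spMat q x y‖ ≤ R) → δ ≤ frameVolR μ i q⁻¹ := by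
  obtain ⟨C, hC0, hC⟩ := exists_frameVolR_mul_le μ (a := a) i R
  -- The upper bound for right translation by `q`, applied at `q⁻¹`, compares with the volume at
  -- `1`; `C + 1` avoids dividing by zero.
  refine ⟨frameVolR μ i (1 : Sp a b F) / (C + 1),
    div_pos (frameVolR_one_pos μ i) (by positivity), fun q hq => ?_⟩
  rw [div_le_iff₀ (by positivity)]
  have := hC q hq q⁻¹
  rw [inv_mul_cancel] at this
  have h2 := frameVolR_nonneg μ i q⁻¹
  nlinarith

end FrameVolume

/-! ### Bounding sections of the Siegel induced representation by frame volumes. -/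

section Growth

open scoped NNReal ENNReal

variable {F : Type*} [NontriviallyNormedField F] [ProperSpace F]
variable {H : Type*} [NormedAddCommGroup H] [InnerProductSpace ℂ H] {a b c : ℕ}

theorem modF_neg (x : F) : modF (-x) = modF x := by
  have h1 : modF (-1 : F) = 1 := by
    refine (pow_eq_one_iff_of_nonneg zero_le two_ne_zero).1 ?_
    rw [pow_two, ← modF_mul, neg_mul_neg, one_mul, modF_one]
  rw [neg_eq_neg_one_mul, modF_mul, h1, one_mul]

theorem ofReal_prod_cpow {ι : Type*} (s : Finset ι) (f : ι → ℝ) (hf : ∀ i, 0 ≤ f i) (z : ℂ) :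
    ((∏ i ∈ s, f i : ℝ) : ℂ) ^ z = ∏ i ∈ s, ((f i : ℝ) : ℂ) ^ z := by
  classical
  induction s using Finset.induction_on with
  | empty => simp
  | insert i s hi ih =>
    rw [Finset.prod_insert hi, Finset.prod_insert hi, Complex.ofReal_mul,
      Complex.mul_cpow_ofReal_nonneg (hf i) (Finset.prod_nonneg fun j _ => hf j), ih]

theorem detAbs_unip {u : GL (Idx a b) F} (hu : IsUnipGL u) : detAbs u = 1 := by
  rw [detAbs_eq_modF, hu.det, modF_one, NNReal.coe_one]

theorem detAbs_one {n : Type*} [Fintype n] [DecidableEq n] : detAbs (1 : GL n F) = 1 := by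
  rw [detAbs_eq_modF, Units.val_one, det_one, modF_one, NNReal.coe_one]

theorem detAbs_blockGL (t : Fin b → GL (Fin a) F) :
    detAbs (blockGL F a b t) = ∏ l, detAbs (t l) := by
  rw [detAbs_eq_modF, det_blockGL, modF_prod, NNReal.coe_prod]
  exact Finset.prod_congr rfl fun l _ => (detAbs_eq_modF _).symm

variable {pi : (Fin b → GL (Fin a) F) →* (H ≃ₗᵢ[ℂ] H)} {Del : Submodule ℂ (GL (Idx a b) F → H)}
  {lam : Fin b → ℂ} {s : ℂ} {Φ : Sp a b F → H}

theorem indSiegel_unip (hDel : Del ≤ indGL pi lam) (hΦ : Φ ∈ indSiegel Del s)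
    {u : GL (Idx a b) F} (hu : IsUnipGL u) (g : Sp a b F) : Φ (leviSp u * g) = Φ g := by
  have h := (hDel (hΦ.2.2 g)).2.1 u 1 hu
  simpa [detAbs_unip hu, detAbs_one, leviSp_one] using h

/-- The function `r ↦ |det r|^{-s-ρ} Φ(m(r) g)` lies in the induced space of `GL`; its equivariance
at `r = 1`, with the determinant factor moved across, gives the total exponent. -/
theorem indSiegel_blockGL (hDel : Del ≤ indGL pi lam) (hΦ : Φ ∈ indSiegel Del s)
    (t : Fin b → GL (Fin a) F) (g : Sp a b F) : Φ (leviSp (blockGL F a b t) * g) =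
      multiAbs t (fun i => s + rhoSiegel a b + (lam i + rhoGL a b i)) • pi t (Φ g) := by
  have h := (hDel (hΦ.2.2 g)).2.2 t 1
  have hne : ((detAbs (blockGL F a b t) : ℝ) : ℂ) ≠ 0 :=
    Complex.ofReal_ne_zero.2 (detAbs_pos _).ne'
  have h1 : ((detAbs (blockGL F a b t) : ℝ) : ℂ) ^ (s + rhoSiegel a b) =
      multiAbs t fun _ => s + rhoSiegel a b := by
    rw [detAbs_blockGL, multiAbs, ofReal_prod_cpow _ _ fun i => (detAbs_pos (t i)).le]
  simp only [mul_one, detAbs_one, Complex.ofReal_one, Complex.one_cpow, leviSp_one, one_mul,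
    one_smul] at h
  have h2 := congrArg (fun v => ((detAbs (blockGL F a b t) : ℝ) : ℂ) ^ (s + rhoSiegel a b) • v) h
  simp only [smul_smul] at h2
  rw [← Complex.cpow_add _ _ hne, h1,
    show s + rhoSiegel a b + (-s - rhoSiegel a b) = 0 by ring, Complex.cpow_zero, one_smul] at h2
  rw [h2]
  congr 1
  rw [multiAbs, multiAbs, multiAbs, ← Finset.prod_mul_distrib]
  refine Finset.prod_congr rfl fun i _ => ?_
  rw [← Complex.cpow_add _ _ (Complex.ofReal_ne_zero.2 (detAbs_pos _).ne')]
  rfl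

theorem norm_multiAbs (t : Fin b → GL (Fin a) F) (lam : Fin b → ℂ) :
    ‖multiAbs t lam‖ = ∏ i, detAbs (t i) ^ (lam i).re := by
  rw [multiAbs, norm_prod]
  exact Finset.prod_congr rfl fun i _ => Complex.norm_cpow_eq_rpow_re_of_pos (detAbs_pos _) _

theorem norm_indSiegel_blockGL (hDel : Del ≤ indGL pi lam) (hΦ : Φ ∈ indSiegel Del s)
    (t : Fin b → GL (Fin a) F) (g : Sp a b F) : ‖Φ (leviSp (blockGL F a b t) * g)‖ =
      (∏ i, detAbs (t i) ^ (s + rhoSiegel a b + (lam i + rhoGL a b i)).re) * ‖Φ g‖ := by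
  rw [indSiegel_blockGL hDel hΦ, norm_smul, norm_multiAbs, LinearIsometryEquiv.norm_map]

/-- The exponents of the frame volumes in the bound for sections of `Ind(Δ, s)`. -/
noncomputable def growthExp (a c : ℕ) (σ : ℝ) : Fin (c + 1) → ℝ :=
  Fin.snoc (α := fun _ => ℝ) (fun _ => (a : ℝ) - 1) (σ + (a + 1 + c) / 2)

/-- Nonnegativity is what allows inequalities between frame volumes to be raised to these powers. -/
theorem growthExp_nonneg (ha : 0 < a) {σ : ℝ} (hσ : 0 ≤ σ) (i : Fin (c + 1)) :
    0 ≤ growthExp a c σ i := by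
  have : (1 : ℝ) ≤ a := by exact_mod_cast ha
  induction i using Fin.lastCases with
  | last => simp only [growthExp, Fin.snoc_last]; positivity
  | cast i => simp only [growthExp, Fin.snoc_castSucc]; linarith

/-- Consecutive entries of `-Λ + ρ` differ by `a - 1`, and the entry at the last block is absorbed
in the last exponent. As `|det t_l|` occurs in the frame volumes with `i ≥ l`, its exponent is a
tail sum. -/
theorem sum_growthExp (l : Fin (c + 1)) :
    ∑ i, (if l ≤ i then growthExp a c s.re i else 0) =
      (s + rhoSiegel a (c + 1) + (-Lam (c + 1) l + rhoGL a (c + 1) l)).re := by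
  have hcard : ∑ i : Fin c, (if l ≤ i.castSucc then ((a : ℝ) - 1) else 0) =
      ((c : ℝ) - (l : ℕ)) * ((a : ℝ) - 1) := by
    have : ∀ i : Fin c, (if l ≤ i.castSucc then ((a : ℝ) - 1) else 0) =
        (fun n : ℕ => if (l : ℕ) ≤ n then ((a : ℝ) - 1) else 0) i := fun i => rfl
    simp_rw [this]
    rw [Fin.sum_univ_eq_sum_range (fun n : ℕ => if (l : ℕ) ≤ n then ((a : ℝ) - 1) else 0) c,
      ← Finset.sum_filter, Finset.sum_const, nsmul_eq_mul,
      show (Finset.range c).filter (fun n => (l : ℕ) ≤ n) = Finset.Ico (l : ℕ) c by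
        ext n; simp [and_comm], Nat.card_Ico, Nat.cast_sub (Nat.lt_succ_iff.1 l.2)]
  rw [Fin.sum_univ_castSucc, if_pos (Fin.le_last l)]
  simp only [growthExp, Fin.snoc_castSucc, Fin.snoc_last]
  rw [hcard]
  simp [rhoSiegel, Lam, rhoGL]
  ring

theorem prod_growth {x : Fin (c + 1) → ℝ} (hx : ∀ l, 0 < x l) :
    ∏ i, (∏ l : {l : Fin (c + 1) // l ≤ i}, x l.1) ^ growthExp a c s.re i =
      ∏ l, x l ^ (s + rhoSiegel a (c + 1) + (-Lam (c + 1) l + rhoGL a (c + 1) l)).re := by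
  have h1 : ∀ i, (∏ l : {l : Fin (c + 1) // l ≤ i}, x l.1) ^ growthExp a c s.re i =
      ∏ l, x l ^ (if l ≤ i then growthExp a c s.re i else 0) := by
    intro i
    rw [← Real.finsetProd_rpow _ _ fun l _ => (hx l.1).le,
      ← Finset.prod_subtype (Finset.univ.filter fun l => l ≤ i) (by simp)
        (fun l => x l ^ growthExp a c s.re i), Finset.prod_filter]
    refine Finset.prod_congr rfl fun l _ => ?_
    split_ifs <;> simp
  simp_rw [h1]
  rw [Finset.prod_comm]
  refine Finset.prod_congr rfl fun l _ => ?_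
  rw [← sum_growthExp, Real.rpow_sum_of_pos (hx l)]

variable [MeasurableSpace F] [BorelSpace F] (μ : Measure F) [μ.IsAddHaarMeasure]

/-- Sections of `Ind(Δ, s)` are bounded by products of powers of the frame volumes. -/
theorem exists_norm_le_frameVolR [CharZero F] {Φ : Sp a (c + 1) F → H}
    {pi : (Fin (c + 1) → GL (Fin a) F) →* (H ≃ₗᵢ[ℂ] H)}
    {Del : Submodule ℂ (GL (Idx a (c + 1)) F → H)} (ha : 0 < a) (hs : 0 ≤ s.re)
    (hDel : Del ≤ indGL pi (-Lam (c + 1))) (hΦ : Φ ∈ indSiegel Del s) :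
    ∃ C : ℝ, 0 ≤ C ∧ ∀ g, ‖Φ g‖ ≤ C * ∏ i, frameVolR μ i g ^ growthExp a c s.re i := by
  obtain ⟨R, hR⟩ := exists_iwasawa F a (c + 1)
  obtain ⟨M, hM⟩ := (isCompact_sp_bounded (F := F) (a := a) (b := c + 1) R).exists_bound_of_continuousOn
    (f := fun q => Φ q⁻¹) (hΦ.1.comp continuous_inv).continuousOn
  choose δ hδ hδ' using fun i : Fin (c + 1) => exists_le_frameVolR_inv (a := a) μ i R
  have hM0 : 0 ≤ max M 0 := le_max_right _ _
  have hP0 : 0 < ∏ i, δ i ^ growthExp a c s.re i :=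
    Finset.prod_pos fun i _ => Real.rpow_pos_of_pos (hδ i) _
  -- Both sides transform identically under the parabolic subgroup, so they need comparing only at
  -- `q⁻¹` for bounded `q`. There `M` bounds `Φ` above and the `δ i` bound the frame volumes below.
  refine ⟨max M 0 / ∏ i, δ i ^ growthExp a c s.re i, div_nonneg hM0 hP0.le, fun g => ?_⟩
  obtain ⟨T, y, q, hT, hq, rfl⟩ := hR g
  obtain ⟨u, t, hu, rfl⟩ := exists_unip_mul_blockGL T hT
  rw [leviSp_mul, mul_assoc, mul_assoc, indSiegel_unip hDel hΦ hu,
    norm_indSiegel_blockGL hDel hΦ, hΦ.2.1]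
  have hvol : ∀ i, frameVolR μ i (leviSp u * (leviSp (blockGL F a (c + 1) t) *
      (siegelN y * q⁻¹))) = (∏ l : {l : Fin (c + 1) // l ≤ i}, detAbs (t l.1)) *
        frameVolR μ i q⁻¹ := by
    intro i
    rw [frameVolR, frameVol_unip_mul μ i hu, frameVol_blockGL_mul, frameVol_siegelN_mul,
      ENNReal.toReal_mul, ENNReal.coe_toReal, NNReal.coe_prod]
    congr 1
    exact Finset.prod_congr rfl fun l _ => (detAbs_eq_modF _).symm
  have hpow : ∏ i, frameVolR μ i (leviSp u * (leviSp (blockGL F a (c + 1) t) *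
      (siegelN y * q⁻¹))) ^ growthExp a c s.re i =
      (∏ l, detAbs (t l) ^ (s + rhoSiegel a (c + 1) + (-Lam (c + 1) l + rhoGL a (c + 1) l)).re) *
        ∏ i, frameVolR μ i q⁻¹ ^ growthExp a c s.re i := by
    rw [← prod_growth fun l => detAbs_pos (t l), ← Finset.prod_mul_distrib]
    refine Finset.prod_congr rfl fun i _ => ?_
    rw [hvol, Real.mul_rpow (Finset.prod_nonneg fun l _ => (detAbs_pos _).le)
      (frameVolR_nonneg μ i _)]
  rw [hpow, mul_left_comm]
  refine mul_le_mul_of_nonneg_left ?_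
    (Finset.prod_nonneg fun l _ => Real.rpow_nonneg (detAbs_pos _).le _)
  rw [div_mul_eq_mul_div, le_div_iff₀ hP0]
  refine mul_le_mul ((hM q hq).trans (le_max_left _ _)) ?_ hP0.le hM0
  exact Finset.prod_le_prod (fun i _ => Real.rpow_nonneg (hδ i).le _) fun i _ =>
    Real.rpow_le_rpow (hδ i).le (hδ' i q hq) (growthExp_nonneg ha hs i)

/-! ### Decay of frame volumes on the big cell. -/

theorem pi_closedBall_one_eq {ι : Type*} [Fintype ι] :
    (Measure.pi fun _ : ι => μ) (Set.univ.pi fun _ => Metric.closedBall (0 : F) 1) =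
      μ (Metric.closedBall (0 : F) 1) ^ Fintype.card ι := by
  rw [Measure.pi_pi, Finset.prod_const, Finset.card_univ]

/-- If the rows of `A` contain the identity matrix, then the volume of `unitSet A` is at most
that of the unit cube, divided by the absolute value of any entry of `A`. -/
theorem measure_unitSet_le {κ ι : Type*} [Fintype ι] [DecidableEq ι] (A : Matrix κ ι F)
    (hA : ∀ i, ∃ k, ∀ j, A k j = if j = i then 1 else 0) (k : κ) (i : ι) :
    (Measure.pi fun _ => μ) (unitSet A) ≤
      (((max 1 (modF (A k i)))⁻¹ : ℝ≥0) : ℝ≥0∞) *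
        μ (Metric.closedBall (0 : F) 1) ^ Fintype.card ι := by
  have hbox : ∀ x ∈ unitSet A, ∀ j, ‖x j‖ ≤ 1 := by
    intro x hx j
    obtain ⟨k', hk'⟩ := hA j
    have := hx k'
    simpa [mulVec, dotProduct, hk'] using this
  rw [← pi_closedBall_one_eq]
  rcases le_total (modF (A k i)) 1 with h1 | h1
  · rw [max_eq_left h1, inv_one, ENNReal.coe_one, one_mul]
    exact measure_mono fun x hx j _ => by simpa using hbox x hx j
  · have h0 : A k i ≠ 0 := by
      intro h; rw [h, modF_zero] at h1; exact absurd h1 (by simp)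
    -- The identity matrix with row `i` replaced by row `k` of `A` still maps `unitSet A` into the
    -- unit cube, so its determinant controls the volume.
    have hdet : ((1 : Matrix ι ι F).updateRow i (A k)).det = A k i := by
      rw [← cramer_transpose_apply, transpose_one, cramer_one, Module.End.one_apply]
    rw [max_eq_right h1, ← hdet, ← measure_preimage_mulVec μ (by rwa [hdet])]
    refine measure_mono fun x hx j _ => ?_
    rw [Metric.mem_closedBall, dist_zero_right]
    by_cases hj : j = i
    · subst hj
      simpa [mulVec] using hx k
    · have : ((1 : Matrix ι ι F).updateRow i (A k) *ᵥ x) j = x j := by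
        simp [mulVec, updateRow_ne hj, dotProduct, Matrix.one_apply]
      change ‖((1 : Matrix ι ι F).updateRow i (A k) *ᵥ x) j‖ ≤ 1
      rw [this]; exact hbox x hx j

theorem exists_frameVolR_le_decay (a c : ℕ) : ∃ D : ℝ, 0 < D ∧ ∀ h : Sp a (c + 1) F,
    (∀ x' : Idx a (c + 1), ∃ k, ∀ x, spMat h⁻¹ k (Sum.inl x) = if x = x' then 1 else 0) →
    (∀ i, frameVolR μ i h ≤ D) ∧ ∀ k x, frameVolR μ (Fin.last c) h ≤
      D * ((max 1 (modF (spMat h⁻¹ k (Sum.inl x))) : ℝ≥0) : ℝ)⁻¹ := by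
  have hB : μ (Metric.closedBall (0 : F) 1) ≠ ∞ := (isCompact_closedBall (0:F) 1).measure_lt_top.ne
  let m : ℝ := max 1 (μ (Metric.closedBall (0 : F) 1)).toReal
  have hm : 1 ≤ m := le_max_left _ _
  refine ⟨m ^ (a * (c + 1)), by positivity, fun h hh => ?_⟩
  have hid : ∀ (i : Fin (c + 1)) (x' : Fin a × {l : Fin (c + 1) // l ≤ i}),
      ∃ k, ∀ x, frame i h k x = if x = x' then 1 else 0 := by
    intro i x'
    obtain ⟨k, hk⟩ := hh (x'.1, x'.2.1)
    refine ⟨k, fun x => ?_⟩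
    rw [frame, submatrix_apply, id, hk]
    simp [Prod.ext_iff, Subtype.ext_iff]
  have main : ∀ i k x, frameVolR μ i h ≤
      m ^ (a * (c + 1)) * ((max 1 (modF (frame i h k x)) : ℝ≥0) : ℝ)⁻¹ := by
    intro i k x
    have h1 := ENNReal.toReal_mono
      (ENNReal.mul_ne_top ENNReal.coe_ne_top (ENNReal.pow_ne_top hB))
      (measure_unitSet_le μ (frame i h) (hid i) k x)
    rw [ENNReal.toReal_mul, ENNReal.coe_toReal, ENNReal.toReal_pow, mul_comm, NNReal.coe_inv] at h1
    refine h1.trans (mul_le_mul_of_nonneg_right ?_ (by positivity))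
    calc _ ≤ m ^ Fintype.card (Fin a × {l : Fin (c + 1) // l ≤ i}) :=
          pow_le_pow_left₀ ENNReal.toReal_nonneg (le_max_right _ _) _
      _ ≤ _ := by
        refine pow_le_pow_right₀ hm ?_
        rw [Fintype.card_prod, Fintype.card_fin]
        refine Nat.mul_le_mul_left _ ?_
        simpa using Fintype.card_subtype_le fun l : Fin (c + 1) => l ≤ i
  refine ⟨fun i => ?_, fun k x => main (Fin.last c) k (x.1, ⟨x.2, Fin.le_last _⟩)⟩
  -- For `a = 0` there is no matrix entry to evaluate `main` at; the space is then a point.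
  rcases isEmpty_or_nonempty (Fin a) with he | ⟨⟨p⟩⟩
  · rw [frameVolR, frameVol]
    have : (Measure.pi fun _ : Fin a × {l : Fin (c + 1) // l ≤ i} => μ) (unitSet (frame i h)) ≤ 1 := by
      refine (measure_mono (Set.subset_univ _)).trans ?_
      rw [Measure.pi_univ]; simp
    calc _ ≤ (1 : ℝ≥0∞).toReal := ENNReal.toReal_mono ENNReal.one_ne_top this
      _ ≤ _ := by rw [ENNReal.toReal_one]; exact one_le_pow₀ hm
  · refine (main i (Sum.inl (p, i)) (p, ⟨i, le_rfl⟩)).trans (mul_le_of_le_one_right (by positivity) ?_)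
    exact inv_le_one_of_one_le₀ (by exact_mod_cast le_max_left _ _)

/-- Uniform bound for sections of `Ind(Δ, s)` along a family of group elements in the big cell. -/
theorem exists_norm_le_prod_decay [CharZero F] {Φ : Sp a (c + 1) F → H}
    {pi : (Fin (c + 1) → GL (Fin a) F) →* (H ≃ₗᵢ[ℂ] H)}
    {Del : Submodule ℂ (GL (Idx a (c + 1)) F → H)} (ha : 0 < a) (J : Type*) [Fintype J]
    (hs : 2 * (Fintype.card J : ℝ) ≤ s.re)
    (hDel : Del ≤ indGL pi (-Lam (c + 1))) (hΦ : Φ ∈ indSiegel Del s) (R : ℝ) :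
    ∃ C : ℝ, ∀ g, (∀ x y, ‖spMat g x y‖ ≤ R) → ∀ (h : Sp a (c + 1) F) (f : J → F),
      (∀ x' : Idx a (c + 1), ∃ k, ∀ x, spMat h⁻¹ k (Sum.inl x) = if x = x' then 1 else 0) →
      (∀ j, ∃ k x, spMat h⁻¹ k (Sum.inl x) = f j ∨ spMat h⁻¹ k (Sum.inl x) = -f j) →
      ‖Φ (h * g)‖ ≤ C * ∏ j, decay (f j) := by
  have hs0 : 0 ≤ s.re := le_trans (by positivity) hs
  let μ : Measure F := Measure.addHaar
  obtain ⟨C, hC0, hC⟩ := exists_norm_le_frameVolR μ ha hs0 hDel hΦ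
  obtain ⟨D, hD0, hD⟩ := exists_frameVolR_le_decay (F := F) μ a c
  choose E hE0 hE using fun i : Fin (c + 1) => exists_frameVolR_mul_le (a := a) μ i R
  let κ := growthExp a c s.re
  have hκ : ∀ i, 0 ≤ κ i := growthExp_nonneg ha hs0
  have hlast : 2 * (Fintype.card J : ℝ) ≤ κ (Fin.last c) := by
    simp only [κ, growthExp, Fin.snoc_last]
    have : (0 : ℝ) ≤ (a + 1 + c) / 2 := by positivity
    linarith
  refine ⟨C * ∏ i, (E i * D) ^ κ i, fun g hg h f hid hf => ?_⟩
  obtain ⟨hD1, hD2⟩ := hD h hid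
  have hdec : ∀ j, frameVolR μ (Fin.last c) h / D ≤ ((max 1 (modF (f j)) : ℝ≥0) : ℝ)⁻¹ := by
    intro j
    obtain ⟨k, x, hkx⟩ := hf j
    rw [div_le_iff₀' hD0]
    refine (hD2 k x).trans (le_of_eq ?_)
    rcases hkx with e | e
    · rw [e]
    · rw [e, modF_neg]
  let w := frameVolR μ (Fin.last c) h / D
  have hw0 : 0 ≤ w := div_nonneg (frameVolR_nonneg μ _ _) hD0.le
  have hw1 : w ≤ 1 := (div_le_one hD0).2 (hD1 _)
  -- Since `w ≤ 1`, its exponent may be lowered to `2 |J|`, which supplies two factors for each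
  -- coordinate. Each is then bounded using that coordinate alone.
  have hwpow : w ^ κ (Fin.last c) ≤ ∏ j, decay (f j) := by
    calc w ^ κ (Fin.last c) ≤ w ^ (((2 * Fintype.card J : ℕ)) : ℝ) := by
          rcases hw0.eq_or_lt with h0 | h0
          · rw [← h0]
            rcases (hκ (Fin.last c)).eq_or_lt with h1 | h1
            · have : Fintype.card J = 0 := by
                have : 2 * (Fintype.card J : ℝ) ≤ 0 := hlast.trans h1.symm.le
                have : (Fintype.card J : ℝ) ≤ 0 := by linarith
                exact_mod_cast le_antisymm this (Nat.cast_nonneg _)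
              rw [← h1, this]; simp
            · rw [Real.zero_rpow h1.ne']; exact Real.rpow_nonneg le_rfl _
          · exact Real.rpow_le_rpow_of_exponent_ge h0 hw1 (by push_cast; exact hlast)
      _ = ∏ _j : J, w ^ 2 := by
        rw [Real.rpow_natCast, Finset.prod_const, Finset.card_univ, ← pow_mul]
      _ ≤ _ := Finset.prod_le_prod (fun _ _ => by positivity) fun j _ =>
        pow_le_pow_left₀ hw0 (hdec j) 2
  calc ‖Φ (h * g)‖ ≤ C * ∏ i, frameVolR μ i (h * g) ^ κ i := hC _
    _ ≤ C * ∏ i, ((E i * D) ^ κ i * (frameVolR μ i h / D) ^ κ i) := by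
      refine mul_le_mul_of_nonneg_left (Finset.prod_le_prod
        (fun i _ => Real.rpow_nonneg (frameVolR_nonneg μ _ _) _) fun i _ => ?_) hC0
      rw [← Real.mul_rpow (mul_nonneg (hE0 i) hD0.le)
        (div_nonneg (frameVolR_nonneg μ _ _) hD0.le), mul_assoc, mul_div_cancel₀ _ hD0.ne']
      exact Real.rpow_le_rpow (frameVolR_nonneg μ _ _) (hE i g hg h) (hκ i)
    _ ≤ C * ((∏ i, (E i * D) ^ κ i) * ∏ j, decay (f j)) := by
      rw [Finset.prod_mul_distrib]
      refine mul_le_mul_of_nonneg_left (mul_le_mul_of_nonneg_left ?_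
        (Finset.prod_nonneg fun i _ => Real.rpow_nonneg (mul_nonneg (hE0 i) hD0.le) _)) hC0
      rw [Fin.prod_univ_castSucc]
      -- Only the last frame volume is used for decay; after division by `D` the others contribute
      -- factors at most `1`.
      refine le_trans (mul_le_of_le_one_left (Real.rpow_nonneg hw0 _) ?_) hwpow
      refine Finset.prod_le_one (fun i _ => Real.rpow_nonneg
        (div_nonneg (frameVolR_nonneg μ _ _) hD0.le) _) fun i _ => ?_
      exact Real.rpow_le_one (div_nonneg (frameVolR_nonneg μ _ _) hD0.le)
        ((div_le_one hD0).2 (hD1 _)) (hκ _)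
    _ = _ := by ring

end Growth

/-! ### Absolute convergence of both integrals and continuity of `U_ŵ Φ`. -/

section Integrability

open scoped NNReal ENNReal

section BigCell

variable {R : Type*} [CommRing R] {a b c : ℕ}

theorem spMat_w0_mul_siegelN_inv (y : Sym2 (Idx a b) → R) :
    spMat (w0 R a b * siegelN y)⁻¹ = fromBlocks (-persym y) (-1) 1 0 := by
  have h : fromBlocks (-persym y) (-1) 1 0 * spMat (w0 R a b * siegelN y) = 1 := by
    rw [spMat_w0_mul_siegelN, fromBlocks_multiply]; simp
  rw [← Matrix.one_mul (spMat (w0 R a b * siegelN y)⁻¹), ← h, Matrix.mul_assoc, spMat_mul_inv,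
    Matrix.mul_one]

theorem spMat_wHat_inv : spMat (wHat R a c)⁻¹ =
    ((wHatMat R a c)ᵀ).submatrix (four a c).symm (four' a c).symm := by
  have h : ((wHatMat R a c)ᵀ).submatrix (four a c).symm (four' a c).symm * spMat (wHat R a c) =
      1 := by
    rw [spMat_wHat, submatrix_mul_equiv]
    simp [wHatMat, fromBlocks_transpose, fromBlocks_multiply, fromBlocks_add]
  rw [← Matrix.one_mul (spMat (wHat R a c)⁻¹), ← h, Matrix.mul_assoc, spMat_mul_inv,
    Matrix.mul_one]

theorem spMat_wHat_mul_vTwo_inv (X : Fin a × Idx a c → R) (z : Sym2 (Fin a) → R) :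
    spMat (wHat R a c * vTwo X z)⁻¹ = (fromBlocks
      (fromBlocks (-(Matrix.of fun p x => X (p, x))) (-(Matrix.of fun p q => z s(p, q.rev))) 1 0)
      (fromBlocks (-1) 0 0 0)
      (fromBlocks 0 (jMat R a c * (Matrix.of fun p x => X (p, x))ᵀ * jSmall R a) 0 1)
      (fromBlocks 0 1 0 0)).submatrix (four a c).symm (four' a c).symm := by
  rw [_root_.mul_inv_rev, ← vTwo_neg, spMat_mul, spMat_wHat_inv, spMat_vTwo, submatrix_mul_equiv]
  have e1 : (Matrix.of fun p x => (-X) (p, x)) = -(Matrix.of fun p x => X (p, x)) := by ext; simp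
  have e2 : (Matrix.of fun p (q : Fin a) => (-z) s(p, q.rev)) =
      -(Matrix.of fun p q => z s(p, q.rev)) := by ext; simp
  simp only [vMat, e1, e2, wHatMat]
  generalize (Matrix.of fun p x => X (p, x)) = A
  generalize (Matrix.of fun p (q : Fin a) => z s(p, q.rev)) = B
  simp [fromBlocks_transpose, fromBlocks_multiply, fromBlocks_add]

end BigCell

section Continuity

variable {F : Type*} [NontriviallyNormedField F] {a b c : ℕ}

theorem continuous_siegelN : Continuous (siegelN : (Sym2 (Idx a b) → F) → Sp a b F) := by
  rw [continuous_sp_iff]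
  simp_rw [spMat_siegelN]
  refine Continuous.matrix_fromBlocks continuous_const ?_ continuous_const continuous_const
  exact continuous_matrix fun i j => continuous_apply _

theorem continuous_vTwo : Continuous fun p : (Fin a × Idx a c → F) × (Sym2 (Fin a) → F) =>
    (vTwo p.1 p.2 : Sp a (c + 1) F) := by
  rw [continuous_sp_iff]
  simp_rw [spMat_vTwo]
  refine Continuous.matrix_submatrix ?_ _ _
  have h1 : Continuous fun p : (Fin a × Idx a c → F) × (Sym2 (Fin a) → F) =>
      (Matrix.of fun r x => p.1 (r, x)) :=
    continuous_matrix fun i j => (continuous_apply (i, j)).comp continuous_fst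
  have h2 : Continuous fun p : (Fin a × Idx a c → F) × (Sym2 (Fin a) → F) =>
      (Matrix.of fun r (q : Fin a) => p.2 s(r, q.rev)) :=
    continuous_matrix fun i j => (continuous_apply s(i, j.rev)).comp continuous_snd
  refine Continuous.matrix_fromBlocks
    (Continuous.matrix_fromBlocks continuous_const h1 continuous_const continuous_const)
    (Continuous.matrix_fromBlocks continuous_const h2 continuous_const continuous_const)
    continuous_const (Continuous.matrix_fromBlocks continuous_const ?_ continuous_const
      continuous_const)
  exact ((continuous_const.matrix_mul h1.matrix_transpose).matrix_mul continuous_const).neg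

theorem continuous_iEmb : Continuous (iEmb : Sp a c F → Sp a (c + 1) F) := by
  rw [continuous_sp_iff]
  simp_rw [spMat_iEmb]
  refine Continuous.matrix_submatrix ?_ _ _
  have h := continuous_spMat (F := F) (a := a) (b := c)
  refine Continuous.matrix_fromBlocks
    (Continuous.matrix_fromBlocks continuous_const continuous_const continuous_const ?_)
    (Continuous.matrix_fromBlocks continuous_const continuous_const ?_ continuous_const)
    (Continuous.matrix_fromBlocks continuous_const ?_ continuous_const continuous_const)
    (Continuous.matrix_fromBlocks ?_ continuous_const continuous_const continuous_const) <;>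
  exact h.matrix_submatrix _ _

theorem eventually_entries_le (g : Sp a b F) :
    ∃ R : ℝ, ∀ᶠ g' in nhds g, ∀ x y, ‖spMat g' x y‖ ≤ R := by
  obtain ⟨R, hR⟩ := exists_entries_le g
  refine ⟨R + 1, ?_⟩
  rw [Filter.eventually_all]
  intro x
  rw [Filter.eventually_all]
  intro y
  have h : Continuous fun g' : Sp a b F => ‖spMat g' x y‖ :=
    (continuous_spMat.matrix_elem x y).norm
  exact ((h.tendsto g).eventually (gt_mem_nhds ((hR x y).trans_lt (lt_add_one R)))).mono
    fun _ h => le_of_lt h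

end Continuity

variable {F : Type*} [NontriviallyNormedField F] [ProperSpace F] [CharZero F]
variable {H : Type*} [NormedAddCommGroup H] [InnerProductSpace ℂ H] {a c : ℕ}
variable [MeasurableSpace F] [BorelSpace F] (μ : Measure F) [μ.IsAddHaarMeasure]
variable {Φ : Sp a (c + 1) F → H} {s : ℂ}
  {pi : (Fin (c + 1) → GL (Fin a) F) →* (H ≃ₗᵢ[ℂ] H)}
  {Del : Submodule ℂ (GL (Idx a (c + 1)) F → H)}

theorem integrable_prod_decay (J : Type*) [Fintype J] :
    Integrable (fun y : J → F => ∏ j, decay (y j)) (Measure.pi fun _ => μ) :=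
  Integrable.fintype_prod (f := fun _ : J => (decay : F → ℝ)) fun _ => integrable_decay μ

/-- The first half of the columns of `(w₀ n(Y))⁻¹` is `(-Y; 1)`: the lower rows form the identity,
and the upper ones show every coordinate up to sign. -/
theorem exists_norm_integrandM_le (ha : 0 < a)
    (hs : 2 * (Fintype.card (Sym2 (Idx a (c + 1))) : ℝ) ≤ s.re)
    (hDel : Del ≤ indGL pi (-Lam (c + 1))) (hΦ : Φ ∈ indSiegel Del s) (g : Sp a (c + 1) F) :
    ∃ C : ℝ, ∀ y, ‖integrandM Φ g y‖ ≤ C * ∏ j, decay (y j) := by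
  obtain ⟨R, hR⟩ := exists_entries_le g
  obtain ⟨C, hC⟩ := exists_norm_le_prod_decay ha (Sym2 (Idx a (c + 1))) hs hDel hΦ R
  refine ⟨C, fun y => hC g hR _ y (fun x' => ⟨Sum.inr x', fun x => ?_⟩) fun j => ?_⟩
  · rw [spMat_w0_mul_siegelN_inv, fromBlocks_apply₂₁, Matrix.one_apply]
    simp [eq_comm]
  · induction j with | _ u v =>
    refine ⟨Sum.inl u, idxRev v, Or.inr ?_⟩
    rw [spMat_w0_mul_siegelN_inv, fromBlocks_apply₁₁]
    simp [persym, idxRev_idxRev]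

theorem integrable_integrandM (ha : 0 < a)
    (hs : 2 * (Fintype.card (Sym2 (Idx a (c + 1))) : ℝ) ≤ s.re)
    (hDel : Del ≤ indGL pi (-Lam (c + 1))) (hΦ : Φ ∈ indSiegel Del s) (g : Sp a (c + 1) F) :
    Integrable (integrandM Φ g) (haarN a (c + 1) μ) := by
  obtain ⟨C, hC⟩ := exists_norm_integrandM_le ha hs hDel hΦ g
  refine ((integrable_prod_decay μ _).const_mul C).mono' ?_ (Filter.Eventually.of_forall hC)
  have : Continuous (integrandM Φ g) :=
    hΦ.1.comp ((continuous_const.mul continuous_siegelN).mul continuous_const)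
  exact this.aestronglyMeasurable

/-- The constant depends on `g` only through a bound for its entries, so the same majorant serves
both for convergence and for continuity in `g`. -/
theorem exists_norm_integrandU_le (ha : 0 < a)
    (hs : 2 * (Fintype.card ((Fin a × Idx a c) ⊕ Sym2 (Fin a)) : ℝ) ≤ s.re)
    (hDel : Del ≤ indGL pi (-Lam (c + 1))) (hΦ : Φ ∈ indSiegel Del s) (R : ℝ) :
    ∃ C : ℝ, ∀ g, (∀ x y, ‖spMat g x y‖ ≤ R) → ∀ p, ‖integrandU Φ g p‖ ≤
      C * ((∏ j, decay (p.1 j)) * ∏ j, decay (p.2 j)) := by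
  obtain ⟨C, hC⟩ := exists_norm_le_prod_decay ha ((Fin a × Idx a c) ⊕ Sym2 (Fin a)) hs hDel hΦ R
  refine ⟨C, fun g hg p => ?_⟩
  have := hC g hg (wHat F a c * vTwo p.1 p.2) (Sum.elim p.1 p.2) (fun x' => ?_) fun j => ?_
  · rwa [Fintype.prod_sum_type] at this
  · obtain ⟨x', rfl⟩ := (splitLast a c).surjective x'
    rw [spMat_wHat_mul_vTwo_inv]
    rcases x' with x' | x'
    · refine ⟨four a c (Sum.inl (Sum.inr x')), fun x => ?_⟩
      obtain ⟨x, rfl⟩ := (splitLast a c).surjective x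
      rcases x with x | x <;> simp [four', Matrix.one_apply, eq_comm]
    · refine ⟨four a c (Sum.inr (Sum.inr x')), fun x => ?_⟩
      obtain ⟨x, rfl⟩ := (splitLast a c).surjective x
      rcases x with x | x <;> simp [four', Matrix.one_apply, eq_comm]
  · rw [spMat_wHat_mul_vTwo_inv]
    rcases j with ⟨q, x⟩ | j
    · refine ⟨four a c (Sum.inl (Sum.inl q)), splitLast a c (Sum.inl x), Or.inr ?_⟩
      simp [four']
    · induction j with | _ u v =>
      refine ⟨four a c (Sum.inl (Sum.inl u)), splitLast a c (Sum.inr v.rev), Or.inr ?_⟩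
      simp [four']

theorem integrable_decay_haarV (a c : ℕ) :
    Integrable (fun p : (Fin a × Idx a c → F) × (Sym2 (Fin a) → F) =>
      (∏ j, decay (p.1 j)) * ∏ j, decay (p.2 j)) (haarV a c μ) :=
  (integrable_prod_decay μ _).mul_prod (integrable_prod_decay μ _)

theorem continuous_integrandU (hΦ : Continuous Φ) (g : Sp a (c + 1) F) :
    Continuous (integrandU Φ g) :=
  hΦ.comp ((continuous_const.mul continuous_vTwo).mul continuous_const)

theorem integrable_integrandU (ha : 0 < a)
    (hs : 2 * (Fintype.card ((Fin a × Idx a c) ⊕ Sym2 (Fin a)) : ℝ) ≤ s.re)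
    (hDel : Del ≤ indGL pi (-Lam (c + 1))) (hΦ : Φ ∈ indSiegel Del s) (g : Sp a (c + 1) F) :
    Integrable (integrandU Φ g) (haarV a c μ) := by
  obtain ⟨R, hR⟩ := exists_entries_le g
  obtain ⟨C, hC⟩ := exists_norm_integrandU_le ha hs hDel hΦ R
  exact ((integrable_decay_haarV μ a c).const_mul C).mono'
    (continuous_integrandU hΦ.1 g).aestronglyMeasurable (Filter.Eventually.of_forall (hC g hR))

/-- Dominated convergence, with a majorant valid on a neighbourhood of `g`. -/
theorem continuous_opU (ha : 0 < a)
    (hs : 2 * (Fintype.card ((Fin a × Idx a c) ⊕ Sym2 (Fin a)) : ℝ) ≤ s.re)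
    (hDel : Del ≤ indGL pi (-Lam (c + 1))) (hΦ : Φ ∈ indSiegel Del s) :
    Continuous (opU μ Φ) := by
  rw [continuous_iff_continuousAt]
  intro g
  obtain ⟨R, hR⟩ := eventually_entries_le g
  obtain ⟨C, hC⟩ := exists_norm_integrandU_le ha hs hDel hΦ R
  refine continuousAt_of_dominated
    (Filter.Eventually.of_forall fun g' => (continuous_integrandU hΦ.1 g').aestronglyMeasurable)
    (hR.mono fun g' hg' => Filter.Eventually.of_forall (hC g' hg'))
    ((integrable_decay_haarV μ a c).const_mul C)
    (Filter.Eventually.of_forall fun p => ?_)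
  exact (hΦ.1.comp (continuous_const.mul continuous_id)).continuousAt

end Integrability

/-! ### Transformation of `i^* U_ŵ Φ` under the parabolic subgroup of the smaller group. -/

section Equivariance

open scoped NNReal ENNReal Kronecker

variable {F : Type*} [NontriviallyNormedField F] {a b c : ℕ}

theorem toBlocks₂₁_of_isUnipSp {u : Sp a b F} (hu : IsUnipSp u) : (spMat u).toBlocks₂₁ = 0 := by
  ext x y
  have := hu (Sum.inr x) (Sum.inl y) (by simp [blockNo]; omega)
  simpa [toBlocks₂₁] using this

theorem exists_unip_siegelN_of_isUnipSp {u : Sp a b F} (hu : IsUnipSp u) :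
    ∃ (m : GL (Idx a b) F) (y : _), IsUnipGL m ∧ u = leviSp m * siegelN y := by
  obtain ⟨m, y, hm, h⟩ := exists_levi_siegelN_of_toBlocks₂₁ (toBlocks₂₁_of_isUnipSp hu)
  refine ⟨m, y, fun x x' hx => ?_, h⟩
  rw [hm, toBlocks₁₁, of_apply, hu _ _ (by simpa [blockNo] using hx)]
  simp [Matrix.one_apply]

theorem splitLast_symm_castSucc (p : Fin a) (l : Fin c) :
    (splitLast a c).symm (p, l.castSucc) = Sum.inl (p, l) :=
  (Equiv.symm_apply_eq _).2 rfl

theorem splitLast_symm_last (p : Fin a) : (splitLast a c).symm (p, Fin.last c) = Sum.inr p :=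
  (Equiv.symm_apply_eq _).2 rfl

theorem IsUnipGL.extGL {m : GL (Idx a c) F} (hm : IsUnipGL m) : IsUnipGL (extGL m) := by
  rintro ⟨p, l⟩ ⟨q, k⟩ h
  induction l using Fin.lastCases with
  | last =>
    induction k using Fin.lastCases with
    | last => simp [_root_.extGL, splitLast_symm_last, Matrix.one_apply]
    | cast k =>
      simp [_root_.extGL, splitLast_symm_last, splitLast_symm_castSucc,
        (Fin.castSucc_lt_last k).ne']
  | cast l =>
    induction k using Fin.lastCases with
    | last => exact absurd h (not_le.2 (Fin.castSucc_lt_last l))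
    | cast k =>
      have := hm (p, l) (q, k) (by simpa using h)
      simp [_root_.extGL, splitLast_symm_castSucc, this, Matrix.one_apply]

theorem isUnipGL_unipLastGL (T : Matrix (Idx a c) (Fin a) F) : IsUnipGL (unipLastGL T) := by
  rintro ⟨p, l⟩ ⟨q, k⟩ h
  induction l using Fin.lastCases with
  | last =>
    induction k using Fin.lastCases with
    | last => simp [unipLastGL, splitLast_symm_last, Matrix.one_apply]
    | cast k =>
      simp [unipLastGL, splitLast_symm_last, splitLast_symm_castSucc,
        (Fin.castSucc_lt_last k).ne']
  | cast l =>
    induction k using Fin.lastCases with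
    | last => exact absurd h (not_le.2 (Fin.castSucc_lt_last l))
    | cast k => simp [unipLastGL, splitLast_symm_castSucc, Matrix.one_apply]

theorem extGL_blockGL (t : Fin c → GL (Fin a) F) : extGL (blockGL F a c t) =
    blockGL F a (c + 1) (Fin.snoc (α := fun _ => GL (Fin a) F) t 1) := by
  apply Units.ext
  rw [coe_blockGL]
  ext ⟨p, l⟩ ⟨q, k⟩
  induction l using Fin.lastCases with
  | last =>
    induction k using Fin.lastCases with
    | last => simp [extGL, splitLast_symm_last, Matrix.one_apply, blockDiagonal_apply]
    | cast k =>
      simp [extGL, splitLast_symm_last, splitLast_symm_castSucc, blockDiagonal_apply,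
        (Fin.castSucc_lt_last k).ne']
  | cast l =>
    induction k using Fin.lastCases with
    | last =>
      simp [extGL, splitLast_symm_last, splitLast_symm_castSucc, blockDiagonal_apply,
        (Fin.castSucc_lt_last l).ne]
    | cast k => simp [extGL, splitLast_symm_castSucc, coe_blockGL, blockDiagonal_apply]

variable [ProperSpace F]
variable {H : Type*} [NormedAddCommGroup H] [InnerProductSpace ℂ H]
variable [MeasurableSpace F] [BorelSpace F] (μ : Measure F) [μ.IsAddHaarMeasure]
variable {Φ : Sp a (c + 1) F → H} {s : ℂ}

instance : SigmaFinite (haarN a b μ) := by unfold haarN; infer_instance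

instance : SigmaFinite (haarV a c μ) := by unfold haarV; infer_instance

/-- `m` acts separately on each of the `a` rows of `X`, so the matrix of the substitution is a
Kronecker product with determinant `(det m)^a`. -/
theorem measurableEmbedding_actX_and_map (m : GL (Idx a c) F) :
    MeasurableEmbedding (actX (m : Matrix (Idx a c) (Idx a c) F) (a := a)) ∧
      Measure.map (actX (m : Matrix (Idx a c) (Idx a c) F)) (Measure.pi fun _ : Fin a × Idx a c => μ) =
        (modF (m : Matrix (Idx a c) (Idx a c) F).det ^ a)⁻¹ • Measure.pi fun _ => μ := by
  let K : Matrix (Fin a × Idx a c) (Fin a × Idx a c) F :=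
    (1 : Matrix (Fin a) (Fin a) F) ⊗ₖ (m : Matrix (Idx a c) (Idx a c) F)ᵀ
  have hK : K.det = (m : Matrix (Idx a c) (Idx a c) F).det ^ a := by
    rw [det_kronecker, det_one, one_pow, one_mul, det_transpose, Fintype.card_fin]
  have hK0 : K.det ≠ 0 := by
    rw [hK]
    exact pow_ne_zero _ ((Matrix.isUnit_iff_isUnit_det _).1 m.isUnit).ne_zero
  have hact : actX (m : Matrix (Idx a c) (Idx a c) F) (a := a) = toLin' K := by
    ext X ⟨p, x⟩
    simp [actX, K, mulVec, dotProduct, Fintype.sum_prod_type, kroneckerMap_apply,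
      Matrix.one_apply, mul_comm]
  have hmod : modF K.det = modF (m : Matrix (Idx a c) (Idx a c) F).det ^ a := by
    rw [hK, modF_pow]
  rw [hact, ← hmod]
  exact ⟨measurableEmbedding_toLin' hK0, map_matrix_pi_eq_smul_pi μ hK0⟩

theorem opU_iEmb_leviSp_mul (m : GL (Idx a c) F) (z : ℂ) (A : H ≃ₗᵢ[ℂ] H)
    (hm : ∀ g, Φ (leviSp (extGL m) * g) = z • A (Φ g)) (g : Sp a (c + 1) F) :
    opU μ Φ (iEmb (leviSp m) * g) = ((detAbs m : ℂ) ^ a)⁻¹ • z • A (opU μ Φ g) := by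
  obtain ⟨he, hmap⟩ := measurableEmbedding_actX_and_map μ m
  have h1 : ∀ p, integrandU Φ (iEmb (leviSp m) * g) p = z • A (integrandU Φ g
      (Prod.map (actX (m : Matrix (Idx a c) (Idx a c) F)) id p)) := by
    intro p
    rw [integrandU, ← mul_assoc, wHat_vTwo_iEmb_leviSp, mul_assoc, hm]
    rfl
  have hmap2 : Measure.map (Prod.map (actX (m : Matrix (Idx a c) (Idx a c) F)) id) (haarV a c μ) =
      (modF (m : Matrix (Idx a c) (Idx a c) F).det ^ a)⁻¹ • haarV a c μ := by
    rw [haarV, ← Measure.map_prod_map _ _ he.measurable measurable_id, hmap, Measure.map_id,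
      Measure.prod_smul_left]
  have h2 := (he.prodMap MeasurableEmbedding.id).integral_map (μ := haarV a c μ) (integrandU Φ g)
  rw [hmap2, integral_smul_nnreal_measure] at h2
  rw [opU]
  simp_rw [h1]
  -- No integrability is needed here, because `A` is invertible.
  have h3 : ∀ f : (Fin a × Idx a c → F) × (Sym2 (Fin a) → F) → H,
      ∫ p, A (f p) ∂haarV a c μ = A (∫ p, f p ∂haarV a c μ) := fun f =>
    A.toContinuousLinearEquiv.integral_comp_comm f
  rw [integral_smul, h3, ← h2, NNReal.smul_def,
    ← Complex.coe_smul, map_smul, smul_comm z, ← opU, detAbs_eq_modF]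
  push_cast
  rfl

/-- The translation of `Z` depends on `X`, so Fubini is used to integrate over `Z` first, with `X`
fixed. -/
theorem opU_iEmb_siegelN_mul {pi : (Fin (c + 1) → GL (Fin a) F) →* (H ≃ₗᵢ[ℂ] H)}
    {Del : Submodule ℂ (GL (Idx a (c + 1)) F → H)} {lam : Fin (c + 1) → ℂ}
    (hDel : Del ≤ indGL pi lam) (hΦ : Φ ∈ indSiegel Del s)
    (hint : ∀ g, Integrable (integrandU Φ g) (haarV a c μ)) (y : Sym2 (Idx a c) → F)
    (g : Sp a (c + 1) F) : opU μ Φ (iEmb (siegelN y) * g) = opU μ Φ g := by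
  have h1 : ∀ p, integrandU Φ (iEmb (siegelN y) * g) p =
      integrandU Φ g (p.1, p.2 + sandwich y p.1) := by
    intro p
    obtain ⟨T, y', h⟩ := wHat_vTwo_iEmb_siegelN p.1 p.2 y
    rw [integrandU, ← mul_assoc, h, mul_assoc, mul_assoc,
      indSiegel_unip hDel hΦ (isUnipGL_unipLastGL T), hΦ.2.1]
    rfl
  have h2 := hint (iEmb (siegelN y) * g)
  rw [opU, opU, haarV, integral_prod _ h2, integral_prod _ (hint g)]
  refine integral_congr_ae (Filter.Eventually.of_forall fun X => ?_)
  simp only [h1]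
  exact integral_add_right_eq_self (fun z => integrandU Φ g (X, z)) (sandwich y X)

theorem multiAbs_snoc (t : Fin c → GL (Fin a) F) (lam : Fin (c + 1) → ℂ) :
    multiAbs (Fin.snoc (α := fun _ => GL (Fin a) F) t 1) lam =
      multiAbs t fun i => lam i.castSucc := by
  rw [multiAbs, Fin.prod_univ_castSucc, multiAbs]
  simp [detAbs_one]

theorem iStar_opU_mem [CharZero F] (ha : 0 < a)
    (hs : 2 * (Fintype.card ((Fin a × Idx a c) ⊕ Sym2 (Fin a)) : ℝ) ≤ s.re)
    {pi : (Fin (c + 1) → GL (Fin a) F) →* (H ≃ₗᵢ[ℂ] H)}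
    {Del : Submodule ℂ (GL (Idx a (c + 1)) F → H)}
    (hDel : Del ≤ indGL pi (-Lam (c + 1))) (hΦ : Φ ∈ indSiegel Del s) :
    iStar (opU μ Φ) ∈ indSp (restrictFirst pi) (fun i => (s - 1 / 2) - Lam c i) := by
  refine ⟨(continuous_opU μ ha hs hDel hΦ).comp continuous_iEmb, fun u g hu => ?_, fun t g => ?_⟩
  · obtain ⟨m, y, hm, rfl⟩ := exists_unip_siegelN_of_isUnipSp hu
    have h1 := opU_iEmb_leviSp_mul μ (Φ := Φ) m 1 (LinearIsometryEquiv.refl ℂ H) (fun g => by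
      rw [indSiegel_unip hDel hΦ hm.extGL]; simp) (iEmb (siegelN y) * iEmb g)
    rw [iStar, mul_assoc, iEmb_mul, iEmb_mul, h1, detAbs_unip hm, opU_iEmb_siegelN_mul μ hDel hΦ
      (integrable_integrandU μ ha hs hDel hΦ)]
    simp [iStar]
  · rw [iStar, iEmb_mul, opU_iEmb_leviSp_mul μ _ _ _ (fun g => by
      rw [extGL_blockGL, indSiegel_blockGL hDel hΦ])]
    rw [smul_smul]
    congr 1
    rw [multiAbs_snoc, detAbs_blockGL, multiAbs, multiAbs, Complex.ofReal_prod,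
      ← Finset.prod_pow, ← Finset.prod_inv_distrib, ← Finset.prod_mul_distrib]
    refine Finset.prod_congr rfl fun i _ => ?_
    rw [← Complex.cpow_natCast, ← Complex.cpow_neg,
      ← Complex.cpow_add _ _ (Complex.ofReal_ne_zero.2 (detAbs_pos _).ne')]
    congr 1
    -- On the first `b - 1` blocks, `-Λ_b = -1/2 - Λ_{b-1}`. The Jacobian exponent `-a` turns the
    -- sum of the Siegel and `GL_{ab}` shifts into the `ρ` of the smaller symplectic group.
    simp [rhoSiegel, Lam, rhoGL, rhoSp]
    ring

/-! ### Splitting the integral over `Y` and conclusion by Fubini. -/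

/-- The coordinates of the blocks of `Y`, as a measurable equivalence. -/
noncomputable def coordSplit (F : Type*) [MeasurableSpace F] (a c : ℕ) :
    (Sym2 (Idx a (c + 1)) → F) ≃ᵐ
      (Sym2 (Idx a c) → F) × ((Fin a × Idx a c → F) × (Sym2 (Fin a) → F)) :=
  (MeasurableEquiv.piCongrLeft (fun _ => F)
    (Equiv.ofBijective _ (coordMap_bijective a c))).symm.trans
    ((MeasurableEquiv.sumPiEquivProdPi fun _ => F).trans
      ((MeasurableEquiv.refl _).prodCongr (MeasurableEquiv.sumPiEquivProdPi fun _ => F)))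

theorem coordSplit_apply (y : Sym2 (Idx a (c + 1)) → F) : coordSplit F a c y =
    (fun p => y (coordMap a c (Sum.inl p)), (fun p => y (coordMap a c (Sum.inr (Sum.inl p))),
      fun p => y (coordMap a c (Sum.inr (Sum.inr p))))) := rfl

theorem measurePreserving_coordSplit :
    MeasurePreserving (coordSplit F a c) (haarN a (c + 1) μ)
      ((haarN a c μ).prod (haarV a c μ)) := by
  refine (measurePreserving_piCongrLeft (fun _ => μ)
    (Equiv.ofBijective _ (coordMap_bijective a c))).symm.trans ?_
  refine (measurePreserving_sumPiEquivProdPi fun _ => μ).trans ?_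
  exact (MeasurePreserving.id _).prod (measurePreserving_sumPiEquivProdPi fun _ => μ)

theorem integrandM_iEmb (g' : Sp a c F) (y : Sym2 (Idx a (c + 1)) → F) :
    integrandM Φ (iEmb g') y = integrandU Φ (iEmb (w0 F a c * siegelN (coordSplit F a c y).1 * g'))
      (coordSplit F a c y).2 := by
  rw [integrandM, integrandU, w0_siegelN_eq, iEmb_mul _ g', coordSplit_apply]
  simp only [mul_assoc]

theorem integrable_integrandU_uncurry (g' : Sp a c F)
    (h : Integrable (integrandM Φ (iEmb g')) (haarN a (c + 1) μ)) :
    Integrable (fun q : (Sym2 (Idx a c) → F) × ((Fin a × Idx a c → F) × (Sym2 (Fin a) → F)) =>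
      integrandU Φ (iEmb (w0 F a c * siegelN q.1 * g')) q.2) ((haarN a c μ).prod (haarV a c μ)) := by
  rw [← (measurePreserving_coordSplit μ).integrable_comp_emb
    (coordSplit F a c).measurableEmbedding]
  exact h.congr (Filter.Eventually.of_forall fun y => integrandM_iEmb g' y)

end Equivariance

theorem lemma4p3 (a c : ℕ) (_ha : 0 < a) :
    ∃ σ₀ : ℝ, ∀ (F : Type*) [NontriviallyNormedField F] [ProperSpace F] [CharZero F]
      [MeasurableSpace F] [BorelSpace F] (μ : Measure F) [μ.IsAddHaarMeasure]
      (H : Type*) [NormedAddCommGroup H] [InnerProductSpace ℂ H] [CompleteSpace H]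
      (pi : (Fin (c + 1) → GL (Fin a) F) →* (H ≃ₗᵢ[ℂ] H))
      (Del : Submodule ℂ (GL (Idx a (c + 1)) F → H)),
      Del ≤ indGL pi (-Lam (c + 1)) →
      (∀ f ∈ Del, ∀ x, (fun m => f (m * x)) ∈ Del) →
      ∀ s : ℂ, σ₀ < s.re → ∀ Φ ∈ indSiegel Del s,
        (∀ g, Integrable (integrandU Φ g) (haarV a c μ)) ∧
        (∀ g, Integrable (integrandM Φ g) (haarN a (c + 1) μ)) ∧
        iStar (opU μ Φ) ∈ indSp (restrictFirst pi) (fun i => (s - 1 / 2) - Lam c i) ∧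
        (∀ g', Integrable (integrandM (iStar (opU μ Φ)) g') (haarN a c μ)) ∧
        opM μ (iStar (opU μ Φ)) = iStar (opM μ Φ) := by
  -- Two units of `Re s` for each integration variable of `M` and of `U_ŵ`; adding the two counts
  -- lets each requirement follow by dropping a nonnegative term.
  refine ⟨2 * Fintype.card (Sym2 (Idx a (c + 1))) +
    2 * Fintype.card ((Fin a × Idx a c) ⊕ Sym2 (Fin a)), ?_⟩
  intro F _ _ _ _ _ μ _ H _ _ _ pi Del hDel _ s hs Φ hΦ
  have hs1 : 2 * (Fintype.card (Sym2 (Idx a (c + 1))) : ℝ) ≤ s.re :=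
    (le_add_of_nonneg_right (by positivity)).trans hs.le
  have hs2 : 2 * (Fintype.card ((Fin a × Idx a c) ⊕ Sym2 (Fin a)) : ℝ) ≤ s.re :=
    (le_add_of_nonneg_left (by positivity)).trans hs.le
  have hM := integrable_integrandM μ _ha hs1 hDel hΦ
  have hG := fun g' => integrable_integrandU_uncurry μ g' (hM (iEmb g'))
  refine ⟨integrable_integrandU μ _ha hs2 hDel hΦ, hM, iStar_opU_mem μ _ha hs2 hDel hΦ,
    -- Convergence of the smaller intertwining integral needs no estimate of its own: a partial
    -- integral of an integrable function on a product is integrable.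
    fun g' => (hG g').integral_prod_left, ?_⟩
  funext g'
  rw [iStar, opM, opM]
  simp_rw [integrandM_iEmb]
  rw [(measurePreserving_coordSplit μ).integral_comp (coordSplit F a c).measurableEmbedding
    fun q => integrandU Φ (iEmb (w0 F a c * siegelN q.1 * g')) q.2, integral_prod _ (hG g')]
  rfl
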